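/- Let $n\ge 1$ and $N\ge n+1$ be integers, and let $Q$ be the equi-oriented quiver $1\to 2\to\cdots\to n$ of type $A_n$. Let $R_{\mathbf d}$ be the affine space of complex representations of $Q$ of dimension vector $\mathbf d=(N,\dots,N)$, i.e. of tuples $(f_1,\dots,f_{n-1})$ of endomorphisms of $\mathbb C^N$, with the base change action of $G_{\mathbf d}=\mathrm{GL}_N(\mathbb C)^n$; its orbits are the isomorphism classes of representations of dimension vector $\mathbf d$. For representations $M,K$ of dimension vector $\mathbf d$, we say that $M$ degenerates to $K$, or that $K$ is a degeneration of $M$, if the (Zariski) closure of the $G_{\mathbf d}$-orbit of $M$ in $R_{\mathbf d}$ contains $K$. For $1\le i\le j\le n$ let $U_{i,j}$ be the indecomposable representation that is $\mathbb C$ at the vertices $i,\dots,j$, with identity maps between them, and $0$ elsewhere. For a tuple $\mathbf a=(a_1,\dots,a_{n-1})$ of non-negative integers with $\sum_k a_k\le N$ let $$M(\mathbf a)=U_{1,n}^{\,N-\sum_k a_k}\oplus\bigoplus_{k=1}^{n-1}\bigl(U_{1,k}\oplus U_{k+1,n}\bigr)^{a_k}.$$ Fix integers $1\le e_1\le e_2\le\cdots\le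 e_n\le N$ and put $$M^1=M(e_2-e_1,\dots,e_n-e_{n-1}),$$ $$M^2=U_{1,n}^{\,N-1-e_n+e_1}\oplus\bigoplus_{k=1}^{n-1}\bigl(U_{1,k}\oplus U_{k+1,n}\bigr)^{e_{k+1}-e_k}\oplus\bigoplus_{i=1}^nU_{i,i}.$$ For $1\le i<n$ let $\mathbf a^i$ be the tuple whose $i$-th entry is $e_{i+1}-e_i+1$ and whose other entries are $0$. For $1\le i<j\le n$ let $\mathbf a^{i,j}$ be the tuple whose $k$-th entry is $e_{k+1}-e_k+\delta_{k,i}+\delta_{k,j-1}$ for $i\le k\le j-1$ and $0$ for all other $k$ (here $\delta$ is the Kronecker symbol). Let $M$ be a representation in $R_{\mathbf d}$. 1. If $M$ degenerates to $M^2$ but not to $M^1$, then $M$ is a degeneration of $M(\mathbf a^i)$ for some $1\le i<n$. 2. If $M$ does not degenerate to $M^2$, then there are $1\le i<j\le n$ such that the entries of $\mathbf a^{i,j}$ have sum at most $N$ and $M$ is a degeneration of $M(\mathbf a^{i,j})$. -/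

import Mathlib

noncomputable section

namespace TypeA

/-- A complex representation of the equi-oriented quiver `1 → 2 → ⋯ → n` of type `A_n`, where
`n = ℓ + 1`. The vertices are the elements of `Fin (ℓ + 1)`: the vertex numbered
`v` in `1, …, n` is `v - 1`. The arrow `k : Fin ℓ` goes from `k.castSucc` to `k.succ`. -/
structure QRep (ℓ : ℕ) where
  space : Fin (ℓ + 1) → Type
  [addCommGroup : ∀ v, AddCommGroup (space v)]
  [module : ∀ v, Module ℂ (space v)]
  map : ∀ k : Fin ℓ, space k.castSucc →ₗ[ℂ] space k.succ

attribute [instance] QRep.addCommGroup QRep.module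

/-- Two representations are isomorphic. -/
def QRep.Isom {ℓ : ℕ} (A B : QRep ℓ) : Prop :=
  ∃ φ : ∀ v, A.space v ≃ₗ[ℂ] B.space v,
    ∀ (k : Fin ℓ) (x : A.space k.castSucc), φ k.succ (A.map k x) = B.map k (φ k.castSucc x)

/-- The indecomposable `U_{i,j}` (for `i ≤ j`): it is `ℂ` at the vertices `v` with `i ≤ v ≤ j`
(functions on a one-point set) and `0` at the others (functions on the empty set); the maps between
two vertices of the support are the identity, all other maps are zero. -/
def interval {ℓ : ℕ} (i j : Fin (ℓ + 1)) : QRep ℓ where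
  space v := PLift (i ≤ v ∧ v ≤ j) → ℂ
  map k :=
    { toFun := fun x _ => if h : i ≤ k.castSucc ∧ k.castSucc ≤ j then x ⟨h⟩ else 0
      map_add' := by
        intro x y
        funext _
        by_cases h : i ≤ k.castSucc ∧ k.castSucc ≤ j <;> simp [h]
      map_smul' := by
        intro c x
        funext _
        by_cases h : i ≤ k.castSucc ∧ k.castSucc ≤ j <;> simp [h] }

/-- The direct sum of a finite family of representations. -/
def directSum {ℓ : ℕ} {ι : Type} [Fintype ι] (A : ι → QRep ℓ) : QRep ℓ where
  space v := ∀ s, (A s).space v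
  map k := LinearMap.pi fun s => (A s).map k ∘ₗ LinearMap.proj s

/-- The representation `⨁_{i ≤ j} U_{i,j}^{m i j}` with multiplicities `m` (the values `m i j` with
`j < i` play no role). -/
def ofMult {ℓ : ℕ} (m : Fin (ℓ + 1) → Fin (ℓ + 1) → ℕ) : QRep ℓ :=
  directSum
    (fun s : (Σ p : {p : Fin (ℓ + 1) × Fin (ℓ + 1) // p.1 ≤ p.2}, Fin (m p.1.1 p.1.2)) =>
      interval s.1.1.1 s.1.1.2)

/-- The affine space `R_d` for `d = (N, …, N)`: tuples of `n - 1 = ℓ` endomorphisms of `ℂ^N`. -/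
abbrev RepSpace (ℓ N : ℕ) : Type := Fin ℓ → Matrix (Fin N) (Fin N) ℂ

/-- A point of `R_d` as a representation. -/
def RepSpace.toQRep {ℓ N : ℕ} (M : RepSpace ℓ N) : QRep ℓ where
  space _ := Fin N → ℂ
  map k := Matrix.mulVecLin (M k)

/-- The base change action of `G_d = GL_N × ⋯ × GL_N` (`n = ℓ + 1` factors) on `R_d`. -/
def baseChange {ℓ N : ℕ} (g : Fin (ℓ + 1) → GL (Fin N) ℂ) (M : RepSpace ℓ N) : RepSpace ℓ N :=
  fun k => (g k.succ : Matrix (Fin N) (Fin N) ℂ) * M k *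
    ((g k.castSucc)⁻¹ : GL (Fin N) ℂ)

/-- The `G_d`-orbit of a point of `R_d`. -/
def orbit {ℓ N : ℕ} (M : RepSpace ℓ N) : Set (RepSpace ℓ N) :=
  Set.range fun g : Fin (ℓ + 1) → GL (Fin N) ℂ => baseChange g M

/-- The Zariski closure of a subset of the affine space `R_d`: the common zeros of all polynomials
in the matrix entries that vanish on the subset. -/
def zariskiClosure {ℓ N : ℕ} (S : Set (RepSpace ℓ N)) : Set (RepSpace ℓ N) :=
  {K | ∀ p : MvPolynomial (Fin ℓ × Fin N × Fin N) ℂ,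
    (∀ M ∈ S, MvPolynomial.eval (fun x => M x.1 x.2.1 x.2.2) p = 0) →
      MvPolynomial.eval (fun x => K x.1 x.2.1 x.2.2) p = 0}

/-- `A` degenerates to `B` (equivalently, `B` is a degeneration of `A`): `A` and `B` are, up to
isomorphism, points of `R_d`, `d = (N, …, N)`, and the point `B` lies in the closure of the
`G_d`-orbit of the point `A`. -/
def Degenerates {ℓ : ℕ} (N : ℕ) (A B : QRep ℓ) : Prop :=
  ∃ L K : RepSpace ℓ N, L.toQRep.Isom A ∧ K.toQRep.Isom B ∧ K ∈ zariskiClosure (orbit L)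

/-- The multiplicities of `M(a)`, for `∑ a_i ≤ N`: in the numbering `1, …, n` of the vertices,
`m_{1,n} = N - ∑ a_i`, `m_{1,i} = a_i` for `i < n`, `m_{i,n} = a_{i-1}` for `i > 1`, and all other
multiplicities are `0`. -/
def multA {ℓ : ℕ} (N : ℕ) (a : Fin ℓ → ℕ) (i j : Fin (ℓ + 1)) : ℕ :=
  if hi : i = 0 then
    if hj : j = Fin.last ℓ then N - ∑ k, a k else a (j.castPred hj)
  else
    if j = Fin.last ℓ then a (i.pred hi) else 0

/-- The representation `M(a)`, for `∑ a_i ≤ N`. -/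
def repA {ℓ : ℕ} (N : ℕ) (a : Fin ℓ → ℕ) : QRep ℓ := ofMult (multA N a)

/-- The tuple `(e_2 - e_1, …, e_n - e_{n-1})`. -/
def diff {ℓ : ℕ} (e : Fin (ℓ + 1) → ℕ) (k : Fin ℓ) : ℕ := e k.succ - e k.castSucc

/-- `M^1 = M(e_2 - e_1, …, e_n - e_{n-1})`. -/
def rep1 {ℓ : ℕ} (N : ℕ) (e : Fin (ℓ + 1) → ℕ) : QRep ℓ := repA N (diff e)

/-- The multiplicities of `M^2`. In the numbering `1, …, n` of the vertices, for `n ≥ 2`: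
`m_{1,1} = e_2 - e_1 + 1`, `m_{n,n} = e_n - e_{n-1} + 1`, `m_{1,n} = N - 1 - e_n + e_1`,
`m_{1,i} = e_{i+1} - e_i`, `m_{i,n} = e_i - e_{i-1}` and `m_{i,i} = 1` for `1 < i < n`, and all
other multiplicities are `0`; for `n = 1`, `m_{1,1} = N`. -/
def mult2 {ℓ : ℕ} (N : ℕ) (e : Fin (ℓ + 1) → ℕ) (i j : Fin (ℓ + 1)) : ℕ :=
  multA (N - 1) (diff e) i j + if i = j then 1 else 0

/-- The representation `M^2`. -/
def rep2 {ℓ : ℕ} (N : ℕ) (e : Fin (ℓ + 1) → ℕ) : QRep ℓ := ofMult (mult2 N e)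

/-- The tuple `a^i`, with `i`-th entry `e_{i+1} - e_i + 1` and all other entries `0`. -/
def tupI {ℓ : ℕ} (e : Fin (ℓ + 1) → ℕ) (i : Fin ℓ) : Fin ℓ → ℕ :=
  fun k => if k = i then diff e i + 1 else 0

/-- The tuple `a^{i,j}`, `i < j`, with `k`-th entry `e_{k+1} - e_k` for `i ≤ k ≤ j - 1`, increased
by `1` for `k = i` and by `1` for `k = j - 1` (hence by `2` if `j = i + 1`), and other entries `0`. -/
def tupIJ {ℓ : ℕ} (e : Fin (ℓ + 1) → ℕ) (i j : Fin (ℓ + 1)) : Fin ℓ → ℕ :=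
  fun k =>
    if i ≤ k.castSucc ∧ k.succ ≤ j then
      diff e k + (if k.castSucc = i then 1 else 0) + (if k.succ = j then 1 else 0)
    else 0

end TypeA

end

/-!
A representation of `1 → ⋯ → n` with all spaces of dimension `N` is a direct sum of intervals, and
the rank of the composite map from `p` to `q` counts the intervals containing `[p, q]`. If the ranks
of `K` are at most those of `L`, then `L` degenerates to `K`: as long as they differ, some two
intervals of `K` can exchange their right ends without any rank exceeding that of `L`, and `K` is a
limit, along an affine line, of points isomorphic to the result; induct on the missing ranks.

Every corank of `M(a)` from `p` to `q` is the sum of the entries of `a` between `p` and `q`, and for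
`M^2` it is one more than for `M^1` when `p < q`. Coranks are subadditive under composition
(Sylvester) and grow with `[p, q]`. So if `M` does not degenerate to `M^1`, a single arrow `i` has
too large a corank, which already dominates all coranks of `M(a^i)`. If `M` does not degenerate to
`M^2`, choose a shortest `[i, j]` whose corank is too large: as the corank of every shorter interval
is bounded, subadditivity along `i ≤ max p i ≤ min q j ≤ j` bounds the corank from `p` to `q` below
by that of `M(a^{i,j})`.
-/

noncomputable section

namespace TypeA

open Module Submodule

section Composite

/-- The composite `f (q - 1) ∘ ⋯ ∘ f p` along the path `p → ⋯ → q`, where `f v` belongs to the arrow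
`v → v + 1`. It is the identity for `q ≤ p`. -/
def composite {R : Type*} [Monoid R] (f : ℕ → R) (p q : ℕ) : R :=
  ((List.Ico p q).map f).reverse.prod

variable {R : Type*} [Monoid R] (f : ℕ → R)

theorem composite_self (p : ℕ) : composite f p p = 1 := by
  simp [composite]

theorem composite_mul_composite {p q r : ℕ} (hpq : p ≤ q) (hqr : q ≤ r) :
    composite f q r * composite f p q = composite f p r := by
  simp [composite, ← List.Ico.append_consecutive hpq hqr]

theorem composite_succ_self (p : ℕ) : composite f p (p + 1) = f p := by
  simp [composite]

theorem composite_succ {p q : ℕ} (hpq : p ≤ q) :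
    composite f p (q + 1) = f q * composite f p q := by
  rw [← composite_mul_composite f hpq q.le_succ, composite_succ_self]

theorem composite_eq_mul {p q : ℕ} (hpq : p < q) :
    composite f p q = composite f (p + 1) q * f p := by
  rw [← composite_mul_composite f p.le_succ hpq, composite_succ_self]

end Composite

theorem composite_apply_mem {R E : Type*} [Semiring R] [AddCommMonoid E] [Module R E]
    {f : ℕ → End R E} {W : ℕ → Submodule R E} (hW : ∀ v, (W v).map (f v) ≤ W (v + 1))
    {p q : ℕ} (hpq : p ≤ q) {x : E} (hx : x ∈ W p) : composite f p q x ∈ W q := by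
  induction q, hpq using Nat.le_induction with
  | base => simpa [composite_self] using hx
  | succ q hpq ih =>
    rw [composite_succ f hpq]
    exact hW q (mem_map_of_mem ih)

section Counting

variable {ι κ : Type*} [Fintype ι] [Fintype κ]

/-- The number of intervals `[a s, b s]` of a family that contain both `p` and `q`, for `p ≤ q`. -/
def numCovering (a b : ι → ℕ) (p q : ℕ) : ℕ :=
  (Finset.univ.filter fun s => a s ≤ p ∧ q ≤ b s).card

/-- The number of intervals `[a s, b s]` of a family that start at `p` and contain `q`, for
`p ≤ q`. -/
def numStarting (a b : ι → ℕ) (p q : ℕ) : ℕ :=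
  (Finset.univ.filter fun s => a s = p ∧ q ≤ b s).card

theorem numCovering_eq_zero {a b : ι → ℕ} {p q : ℕ} (hb : ∀ s, b s < q) :
    numCovering a b p q = 0 :=
  Finset.card_eq_zero.2 <| Finset.filter_eq_empty_iff.2 fun s _ hs => (hb s).not_ge hs.2

theorem numCovering_zero (a b : ι → ℕ) (q : ℕ) : numCovering a b 0 q = numStarting a b 0 q := by
  simp [numCovering, numStarting]

theorem numCovering_succ (a b : ι → ℕ) (p q : ℕ) :
    numCovering a b (p + 1) q = numCovering a b p q + numStarting a b (p + 1) q := by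
  simp only [numCovering, numStarting, Finset.card_filter, ← Finset.sum_add_distrib]
  exact Finset.sum_congr rfl fun s _ => by split_ifs <;> omega

theorem numStarting_add_numCovering (a b : ι → ℕ) (a' b' : κ → ℕ) (p q : ℕ)
    (h : ∀ p' < p, numCovering a b p' q = numCovering a' b' p' q) :
    numStarting a b p q + numCovering a' b' p q = numStarting a' b' p q + numCovering a b p q := by
  cases p with
  | zero => rw [numCovering_zero, numCovering_zero, Nat.add_comm]
  | succ p =>
    have := h p p.lt_succ_self
    rw [numCovering_succ, numCovering_succ]
    omega

theorem numStarting_eq_add_card (a b : ι → ℕ) (p q : ℕ) :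
    numStarting a b p q =
      numStarting a b p (q + 1) + (Finset.univ.filter fun s => (a s, b s) = (p, q)).card := by
  simp only [numStarting, Finset.card_filter, ← Finset.sum_add_distrib, Prod.mk.injEq]
  exact Finset.sum_congr rfl fun s _ => by split_ifs <;> omega

theorem exists_equiv_of_numCovering_eq {a b : ι → ℕ} {a' b' : κ → ℕ} (hab : ∀ s, a s ≤ b s)
    (hab' : ∀ s, a' s ≤ b' s)
    (h : ∀ p q, p ≤ q → numCovering a b p q = numCovering a' b' p q) :
    ∃ σ : κ ≃ ι, a ∘ σ = a' ∧ b ∘ σ = b' := by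
  classical
  have hfibre : ∀ c : ℕ × ℕ,
      Fintype.card {s // (a' s, b' s) = c} = Fintype.card {s // (a s, b s) = c} := by
    rintro ⟨i, j⟩
    by_cases hij : i ≤ j
    · have hstart : ∀ y, i ≤ y → numStarting a b i y = numStarting a' b' i y := fun y hy => by
        have := numStarting_add_numCovering a b a' b' i y fun p hp => h p y (by omega)
        have := h i y hy
        omega
      have := numStarting_eq_add_card a b i j
      have := numStarting_eq_add_card a' b' i j
      have := hstart j hij
      have := hstart (j + 1) (by omega)
      rw [Fintype.card_subtype, Fintype.card_subtype]
      omega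
    · have : IsEmpty {s // (a s, b s) = (i, j)} := ⟨fun ⟨s, hs⟩ => by
        obtain ⟨rfl, rfl⟩ := Prod.mk.inj hs
        exact hij (hab s)⟩
      have : IsEmpty {s // (a' s, b' s) = (i, j)} := ⟨fun ⟨s, hs⟩ => by
        obtain ⟨rfl, rfl⟩ := Prod.mk.inj hs
        exact hij (hab' s)⟩
      rw [Fintype.card_eq_zero, Fintype.card_eq_zero]
  let e c := Fintype.equivOfCardEq (hfibre c)
  refine ⟨Equiv.ofFiberEquiv e, funext fun s => ?_, funext fun s => ?_⟩
  · exact congrArg Prod.fst (Equiv.ofFiberEquiv_map e s)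
  · exact congrArg Prod.snd (Equiv.ofFiberEquiv_map e s)

end Counting

section IntervalBasis

variable {𝕜 E : Type*} [Field 𝕜] [AddCommGroup E] [Module 𝕜 E]

/-- A decomposition into interval representations `[a s, b s]` of the representation of
`0 → 1 → 2 → ⋯` with spaces `W v ≤ E` and maps induced by `f v`: the non-zero vectors among
`x s 0, x s 1, …` span the `s`-th summand. Linear independence at a vertex is encoded by the
number of spanning vectors. -/
structure IntervalBasis (f : ℕ → End 𝕜 E) (W : ℕ → Submodule 𝕜 E) {ι : Type*} [Fintype ι]
    (a b : ι → ℕ) (x : ι → ℕ → E) : Prop where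
  zero : ∀ s v, ¬ (a s ≤ v ∧ v ≤ b s) → x s v = 0
  map : ∀ s v, a s ≤ v → f v (x s v) = x s (v + 1)
  card : ∀ v, numCovering a b v v = finrank 𝕜 (W v)
  span : ∀ v, span 𝕜 (Set.range fun s => x s v) = W v

namespace IntervalBasis

variable {f : ℕ → End 𝕜 E} {W : ℕ → Submodule 𝕜 E} {ι κ : Type*} [Fintype ι] [Fintype κ]
  {a b : ι → ℕ} {x : ι → ℕ → E}

theorem span_subtype (h : IntervalBasis f W a b x) (v : ℕ) :
    Submodule.span 𝕜 (Set.range fun s : {s // a s ≤ v ∧ v ≤ b s} => x s v) = W v := by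
  rw [← h.span v]
  refine le_antisymm (span_mono (Set.range_comp_subset_range _ fun s => x s v))
    (span_le.2 ?_)
  rintro _ ⟨s, rfl⟩
  by_cases hs : a s ≤ v ∧ v ≤ b s
  · exact subset_span ⟨⟨s, hs⟩, rfl⟩
  · simp [h.zero s v hs]

theorem linearIndependent (h : IntervalBasis f W a b x) (v : ℕ) :
    LinearIndependent 𝕜 fun s : {s // a s ≤ v ∧ v ≤ b s} => x s v := by
  rw [linearIndependent_iff_card_eq_finrank_span, Set.finrank, h.span_subtype, ← h.card,
    Fintype.card_subtype, numCovering]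

theorem composite_apply (h : IntervalBasis f W a b x) (s : ι) {p q : ℕ} (hp : a s ≤ p)
    (hpq : p ≤ q) : composite f p q (x s p) = x s q := by
  induction q, hpq using Nat.le_induction with
  | base => simp [composite_self]
  | succ q hpq ih =>
    rw [composite_succ f hpq, Module.End.mul_apply, ih, h.map s q (hp.trans hpq)]

theorem map_composite_eq_span (h : IntervalBasis f W a b x) {p q : ℕ} (hpq : p ≤ q) :
    (W p).map (composite f p q) =
      Submodule.span 𝕜 (Set.range fun s : {s // a s ≤ p ∧ q ≤ b s} => x s q) := by
  rw [← h.span p, map_span, ← Set.range_comp]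
  refine le_antisymm (span_le.2 ?_) (span_mono ?_)
  · rintro _ ⟨s, rfl⟩
    by_cases hs : a s ≤ p
    · rw [Function.comp_apply, h.composite_apply s hs hpq]
      by_cases hb : q ≤ b s
      · exact subset_span ⟨⟨s, hs, hb⟩, rfl⟩
      · simp [h.zero s q (by omega)]
    · simp [h.zero s p (by omega)]
  · rintro _ ⟨s, rfl⟩
    exact ⟨s, h.composite_apply s s.2.1 hpq⟩

theorem finrank_map_composite (h : IntervalBasis f W a b x) {p q : ℕ} (hpq : p ≤ q) :
    finrank 𝕜 ((W p).map (composite f p q)) = numCovering a b p q := by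
  have hind : LinearIndependent 𝕜 fun s : {s // a s ≤ p ∧ q ≤ b s} => x s q :=
    (h.linearIndependent q).comp
      (fun s : {s // a s ≤ p ∧ q ≤ b s} => ⟨s, s.2.1.trans hpq, s.2.2⟩)
      fun s t hst => Subtype.ext (congrArg (fun u => u.1) hst)
  rw [h.map_composite_eq_span hpq, finrank_span_eq_card hind, Fintype.card_subtype, numCovering]

theorem reindex (h : IntervalBasis f W a b x) (σ : κ ≃ ι) :
    IntervalBasis f W (a ∘ σ) (b ∘ σ) (x ∘ σ) where
  zero s := h.zero (σ s)
  map s := h.map (σ s)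
  card v := by
    rw [← h.card v, numCovering, numCovering, ← Fintype.card_subtype, ← Fintype.card_subtype]
    exact Fintype.card_congr (σ.subtypeEquiv fun s => Iff.rfl)
  span v := by
    rw [← h.span v]
    exact congrArg _ (σ.surjective.range_comp fun s => x s v)

theorem rescale (h : IntervalBasis f W a b x) {w : ι → 𝕜} (hw : ∀ s, w s ≠ 0) :
    IntervalBasis f W a b fun s v => w s • x s v where
  zero s v hv := by rw [h.zero s v hv, smul_zero]
  map s v hv := by rw [map_smul, h.map s v hv]
  card := h.card
  span v := by
    rw [← h.span v]
    refine span_eq_span ?_ ?_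
    · rintro _ ⟨s, rfl⟩
      exact smul_mem _ _ (subset_span ⟨s, rfl⟩)
    · rintro _ ⟨s, rfl⟩
      exact (smul_mem_iff _ (hw s)).1 (subset_span ⟨s, rfl⟩)

theorem exists_linearMap (h : IntervalBasis f W a b x) (v : ℕ) (z : ι → E) :
    ∃ g : End 𝕜 E, ∀ s, a s ≤ v → v ≤ b s → g (x s v) = z s := by
  have hind := h.linearIndependent v
  obtain ⟨g, hg⟩ := LinearMap.exists_extend
    ((Basis.span hind).constr 𝕜 fun s : {s // a s ≤ v ∧ v ≤ b s} => z s)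
  refine ⟨g, fun s ha hb => ?_⟩
  have hs := (Basis.span hind).constr_basis 𝕜 (fun s : {s // a s ≤ v ∧ v ≤ b s} => z s) ⟨s, ha, hb⟩
  rwa [← hg, LinearMap.comp_apply, Basis.span_apply] at hs

end IntervalBasis

end IntervalBasis

section Existence

variable {𝕜 E : Type*} [Field 𝕜] [AddCommGroup E] [Module 𝕜 E]

theorem inf_ker_sup_span_singleton {W : Submodule 𝕜 E} {ψ : Dual 𝕜 E} {z : E} (hz : z ∈ W)
    (hψ : ψ z = 1) : W ⊓ LinearMap.ker ψ ⊔ span 𝕜 {z} = W := by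
  refine le_antisymm (sup_le inf_le_left ((span_singleton_le_iff_mem z W).2 hz)) fun w hw => ?_
  rw [← sub_add_cancel w (ψ w • z)]
  exact add_mem (mem_sup_left ⟨sub_mem hw (smul_mem _ _ hz), by simp [hψ]⟩)
    (mem_sup_right (smul_mem _ _ (mem_span_singleton_self z)))

theorem finrank_inf_ker_add_one [FiniteDimensional 𝕜 E] {W : Submodule 𝕜 E} {ψ : Dual 𝕜 E}
    {z : E} (hz : z ∈ W) (hψ : ψ z = 1) :
    finrank 𝕜 ↥(W ⊓ LinearMap.ker ψ) + 1 = finrank 𝕜 W := by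
  have hz0 : z ≠ 0 := by
    rintro rfl
    simp at hψ
  have hdisj : W ⊓ LinearMap.ker ψ ⊓ span 𝕜 {z} = ⊥ := by
    refine eq_bot_iff.2 ?_
    rintro y ⟨⟨-, hy⟩, hyz⟩
    obtain ⟨c, rfl⟩ := mem_span_singleton.1 hyz
    have hc : c = 0 := by simpa [hψ] using hy
    simp [hc]
  have := finrank_sup_add_finrank_inf_eq (W ⊓ LinearMap.ker ψ) (span 𝕜 {z})
  rwa [inf_ker_sup_span_singleton hz hψ, hdisj, finrank_bot, finrank_span_singleton hz0, add_zero,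
    eq_comm] at this

variable {f : ℕ → End 𝕜 E} {W : ℕ → Submodule 𝕜 E}

theorem exists_last_composite_ne_zero (hW : ∀ v, (W v).map (f v) ≤ W (v + 1)) {ℓ : ℕ}
    (hℓ : ∀ v, ℓ < v → W v = ⊥) {i : ℕ} {x : E} (hx : x ∈ W i) (hx0 : x ≠ 0) :
    ∃ j, i ≤ j ∧ j ≤ ℓ ∧ composite f i j x ≠ 0 ∧ composite f i (j + 1) x = 0 := by
  classical
  have hi : i ≤ ℓ := by
    by_contra! hlt
    rw [hℓ i hlt] at hx
    exact hx0 hx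
  have hxi : composite f i i x ≠ 0 := by simpa [composite_self] using hx0
  have hij := Nat.le_findGreatest (P := fun j => composite f i j x ≠ 0) hi hxi
  refine ⟨_, hij, Nat.findGreatest_le ℓ,
    Nat.findGreatest_spec (P := fun j => composite f i j x ≠ 0) hi hxi, ?_⟩
  by_contra hne
  rcases le_or_gt (Nat.findGreatest (fun j => composite f i j x ≠ 0) ℓ + 1) ℓ with hle | hlt
  · exact Nat.findGreatest_is_greatest (Nat.lt_succ_self _) hle hne
  · have := composite_apply_mem hW (hij.trans (Nat.le_succ _)) hx
    rw [hℓ _ hlt] at this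
    exact hne this

theorem exists_interval_complement [FiniteDimensional 𝕜 E]
    (hW : ∀ v, (W v).map (f v) ≤ W (v + 1)) {i j : ℕ} (hbot : ∀ v < i, W v = ⊥) {x : E}
    (hx : x ∈ W i) (hne : composite f i j x ≠ 0) :
    ∃ C : ℕ → Submodule 𝕜 E, (∀ v, (C v).map (f v) ≤ C (v + 1)) ∧
      (∀ v, ¬ (i ≤ v ∧ v ≤ j) → C v = W v) ∧
      ∀ v, i ≤ v → v ≤ j → finrank 𝕜 (C v) + 1 = finrank 𝕜 (W v) ∧
        C v ⊔ span 𝕜 {composite f i v x} = W v := by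
  obtain ⟨φ, hφ⟩ := Module.Projective.exists_dual_eq_one 𝕜 hne
  let ψ v : Dual 𝕜 E := if v ≤ j then φ ∘ₗ composite f v j else 0
  refine ⟨fun v => W v ⊓ LinearMap.ker (ψ v), fun v => ?_, fun v hv => ?_, fun v hiv hvj => ?_⟩
  · rintro _ ⟨y, ⟨hyW, hyψ⟩, rfl⟩
    refine ⟨hW v (mem_map_of_mem hyW), ?_⟩
    by_cases hvj : v + 1 ≤ j
    · simpa [ψ, hvj, Nat.le_of_succ_le hvj, composite_eq_mul f hvj] using hyψ
    · simp [ψ, hvj]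
  · rcases lt_or_ge v i with hlt | hge
    · simp [hbot v hlt]
    · simp [ψ, show ¬ v ≤ j by omega]
  · have hz : composite f i v x ∈ W v := composite_apply_mem hW hiv hx
    have hψz : ψ v (composite f i v x) = 1 := by
      simp only [ψ, if_pos hvj, LinearMap.comp_apply]
      rw [← Module.End.mul_apply, composite_mul_composite f hiv hvj, hφ]
    exact ⟨finrank_inf_ker_add_one hz hψz, inf_ker_sup_span_singleton hz hψz⟩

theorem exists_interval_summand [FiniteDimensional 𝕜 E] (hW : ∀ v, (W v).map (f v) ≤ W (v + 1))
    {ℓ : ℕ} (hℓ : ∀ v, ℓ < v → W v = ⊥) (h0 : ∃ v, W v ≠ ⊥) :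
    ∃ (C : ℕ → Submodule 𝕜 E) (z : ℕ → E) (i j : ℕ), i ≤ j ∧ j ≤ ℓ ∧
      (∀ v, (C v).map (f v) ≤ C (v + 1)) ∧ (∀ v, ¬ (i ≤ v ∧ v ≤ j) → z v = 0) ∧
      (∀ v, i ≤ v → f v (z v) = z (v + 1)) ∧
      (∀ v, finrank 𝕜 (C v) + (if i ≤ v ∧ v ≤ j then 1 else 0) = finrank 𝕜 (W v)) ∧
      ∀ v, C v ⊔ span 𝕜 {z v} = W v := by
  classical
  obtain ⟨x, hx, hx0⟩ := (Submodule.ne_bot_iff _).1 (Nat.find_spec h0)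
  have hbot : ∀ v < Nat.find h0, W v = ⊥ := fun v hv => not_not.1 (Nat.find_min h0 hv)
  generalize Nat.find h0 = i at hx hbot
  obtain ⟨j, hij, hjℓ, hne, hzero⟩ := exists_last_composite_ne_zero hW hℓ hx hx0
  obtain ⟨C, hC, hCout, hCin⟩ := exists_interval_complement hW hbot hx hne
  refine ⟨C, fun v => if i ≤ v ∧ v ≤ j then composite f i v x else 0, i, j, hij, hjℓ, hC,
    fun v hv => if_neg hv, fun v hv => ?_, fun v => ?_, fun v => ?_⟩
  · beta_reduce
    rcases lt_trichotomy v j with hlt | rfl | hgt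
    · rw [if_pos (by omega), if_pos (by omega), composite_succ f hv, Module.End.mul_apply]
    · rw [if_pos (by omega), if_neg (by omega), ← Module.End.mul_apply, ← composite_succ f hv,
        hzero]
    · rw [if_neg (by omega), if_neg (by omega), map_zero]
  · split_ifs with hv
    · exact (hCin v hv.1 hv.2).1
    · rw [hCout v hv, add_zero]
  · beta_reduce
    split_ifs with hv
    · exact (hCin v hv.1 hv.2).2
    · rw [hCout v hv, span_zero_singleton, sup_bot_eq]

theorem IntervalBasis.option {C : ℕ → Submodule 𝕜 E} {ι : Type*} [Fintype ι] {a b : ι → ℕ}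
    {x : ι → ℕ → E} (h : IntervalBasis f C a b x) {i j : ℕ} {z : ℕ → E}
    (hzero : ∀ v, ¬ (i ≤ v ∧ v ≤ j) → z v = 0) (hmap : ∀ v, i ≤ v → f v (z v) = z (v + 1))
    (hrank : ∀ v, finrank 𝕜 (C v) + (if i ≤ v ∧ v ≤ j then 1 else 0) = finrank 𝕜 (W v))
    (hspan : ∀ v, C v ⊔ Submodule.span 𝕜 {z v} = W v) :
    IntervalBasis f W (fun s : Option ι => s.elim i a) (fun s => s.elim j b)
      (fun s => s.elim z x) where
  zero := Option.forall.2 ⟨hzero, h.zero⟩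
  map := Option.forall.2 ⟨hmap, h.map⟩
  card v := by
    rw [← hrank v, ← h.card v, numCovering, numCovering, Finset.card_filter, Finset.card_filter,
      Fintype.sum_option, add_comm]
    rfl
  span v := by
    have hrange : (Set.range fun s : Option ι => s.elim z x v) =
        Set.range (fun s => x s v) ∪ {z v} := by
      ext y
      simp [Option.exists, eq_comm (a := z v)]
    rw [hrange, span_union, h.span v, hspan v]

theorem exists_intervalBasis [FiniteDimensional 𝕜 E] (f : ℕ → End 𝕜 E) (ℓ : ℕ)
    (W : ℕ → Submodule 𝕜 E) (hW : ∀ v, (W v).map (f v) ≤ W (v + 1))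
    (hℓ : ∀ v, ℓ < v → W v = ⊥) :
    ∃ (ι : Type) (_ : Fintype ι) (a b : ι → ℕ) (x : ι → ℕ → E),
      (∀ s, a s ≤ b s ∧ b s ≤ ℓ) ∧ IntervalBasis f W a b x := by
  induction hn : ∑ v ∈ Finset.range (ℓ + 1), finrank 𝕜 (W v) using Nat.strong_induction_on
    generalizing W with
  | _ n ih =>
    by_cases h0 : ∀ v, W v = ⊥
    · obtain rfl : W = fun _ => ⊥ := funext h0
      exact ⟨Empty, inferInstance, Empty.elim, Empty.elim, Empty.elim, fun s => s.elim,
        fun s => s.elim, fun s => s.elim, fun v => by simp [numCovering], fun v => by simp⟩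
    obtain ⟨C, z, i, j, hij, hjℓ, hC, hzero, hmap, hrank, hspan⟩ :=
      exists_interval_summand hW hℓ (not_forall.1 h0)
    have hlt : ∑ v ∈ Finset.range (ℓ + 1), finrank 𝕜 (C v) < n := by
      rw [← hn]
      refine Finset.sum_lt_sum (fun v _ => (hrank v).le.trans' (Nat.le_add_right _ _))
        ⟨i, Finset.mem_range.2 (by omega), ?_⟩
      rw [← hrank i, if_pos ⟨le_rfl, hij⟩]
      exact Nat.lt_succ_self _
    obtain ⟨ι, hι, a, b, x, hab, hx⟩ := ih _ hlt C hC
      (fun v hv => le_bot_iff.1 (hℓ v hv ▸ hspan v ▸ le_sup_left)) rfl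
    exact ⟨Option ι, inferInstance, _, _, _, Option.forall.2 ⟨⟨hij, hjℓ⟩, hab⟩,
      hx.option hzero hmap hrank hspan⟩

end Existence

section Exchange

variable {ι κ : Type*} [Fintype ι] [Fintype κ]

theorem numCovering_add_numCovering (a b : ι → ℕ) {p p' q q' : ℕ} (hp : p ≤ p') (hq : q ≤ q') :
    numCovering a b p' q + numCovering a b p q' =
      numCovering a b p q + numCovering a b p' q' +
        (Finset.univ.filter fun s => (p < a s ∧ a s ≤ p') ∧ q ≤ b s ∧ b s < q').card := by
  simp only [numCovering, Finset.card_filter, ← Finset.sum_add_distrib]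
  exact Finset.sum_congr rfl fun s _ => by split_ifs <;> omega

theorem numCovering_lt_of_forall_not_mem_box {a b : ι → ℕ} {a' b' : κ → ℕ} {p p' q q' : ℕ}
    (hp : p ≤ p') (hq : q ≤ q') (hlt : numCovering a' b' p q < numCovering a b p q)
    (heq : numCovering a' b' p q' = numCovering a b p q')
    (hle : numCovering a' b' p' q' ≤ numCovering a b p' q')
    (hbox : ∀ t, p < a' t → q ≤ b' t → b' t < q' → p' < a' t) :
    numCovering a' b' p' q < numCovering a b p' q := by
  have hempty : (Finset.univ.filter fun s => (p < a' s ∧ a' s ≤ p') ∧ q ≤ b' s ∧ b' s < q') = ∅ :=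
    Finset.filter_eq_empty_iff.2 fun t _ ht =>
      (hbox t ht.1.1 ht.2.1 ht.2.2).not_ge ht.1.2
  have hK := numCovering_add_numCovering a' b' hp hq
  have hL := numCovering_add_numCovering a b hp hq
  rw [hempty, Finset.card_empty] at hK
  omega

theorem exists_min_row_max_column {P : ℕ → ℕ → Prop} {ℓ : ℕ} (hℓ : ∀ p q, P p q → q ≤ ℓ)
    (hP : ∃ p q, P p q) : ∃ p q, P p q ∧ (∀ p' < p, ∀ y, ¬ P p' y) ∧ ∀ y, q < y → ¬ P p y := by
  classical
  obtain ⟨q, hq⟩ := Nat.find_spec hP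
  refine ⟨Nat.find hP, Nat.findGreatest (P (Nat.find hP)) ℓ,
    Nat.findGreatest_spec (hℓ _ q hq) hq, fun p' hp' => not_exists.1 (Nat.find_min hP hp'),
    fun y hy hPy => ?_⟩
  exact hy.not_ge (Nat.le_findGreatest (hℓ _ y hPy) hPy)

theorem numCovering_lt_of_forall_starting {a b : ι → ℕ} {a' b' : κ → ℕ} {p y q : ℕ} (hpy : p ≤ y)
    (hyq : y ≤ q) (hrows : ∀ p' < p, ∀ y, p' ≤ y → numCovering a' b' p' y = numCovering a b p' y)
    (hlt : numCovering a' b' p q < numCovering a b p q)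
    (hgap : ∀ s, a' s = p → y ≤ b' s → q ≤ b' s) :
    numCovering a' b' p y < numCovering a b p y := by
  have hstart : ∀ y, p ≤ y → numStarting a' b' p y + numCovering a b p y =
      numStarting a b p y + numCovering a' b' p y := fun y hy =>
    numStarting_add_numCovering a' b' a b p y fun p' hp' => hrows p' hp' y (hp'.le.trans hy)
  have hK : numStarting a' b' p y ≤ numStarting a' b' p q :=
    Finset.card_le_card (Finset.monotone_filter_right _ fun s _ hs => ⟨hs.1, hgap s hs.1 hs.2⟩)
  have hL : numStarting a b p q ≤ numStarting a b p y :=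
    Finset.card_le_card (Finset.monotone_filter_right _ fun s _ hs => ⟨hs.1, hyq.trans hs.2⟩)
  have := hstart y hpy
  have := hstart q (hpy.trans hyq)
  omega

theorem exists_left_interval {a b : ι → ℕ} {a' b' : κ → ℕ} (hab' : ∀ s, a' s ≤ b' s) {p q : ℕ}
    (hpq : p ≤ q) (hrows : ∀ p' < p, ∀ y, p' ≤ y → numCovering a' b' p' y = numCovering a b p' y)
    (hdiag : numCovering a' b' p p = numCovering a b p p)
    (hlt : numCovering a' b' p q < numCovering a b p q) :
    ∃ s, a' s = p ∧ b' s < q ∧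
      ∀ y, b' s < y → y ≤ q → numCovering a' b' p y < numCovering a b p y := by
  have hS : (Finset.univ.filter fun s => a' s = p ∧ b' s < q).Nonempty := by
    by_contra hempty
    rw [Finset.not_nonempty_iff_eq_empty, Finset.filter_eq_empty_iff] at hempty
    refine (numCovering_lt_of_forall_starting le_rfl hpq hrows hlt fun s hs _ => ?_).ne hdiag
    exact not_lt.1 fun h => hempty (Finset.mem_univ s) ⟨hs, h⟩
  obtain ⟨s, hs, hmax⟩ := Finset.exists_max_image _ b' hS
  simp only [Finset.mem_filter, Finset.mem_univ, true_and] at hs hmax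
  obtain ⟨rfl, hsq⟩ := hs
  refine ⟨s, rfl, hsq, fun y hy hyq => ?_⟩
  refine numCovering_lt_of_forall_starting ((hab' s).trans hy.le) hyq hrows hlt fun t ht hyt => ?_
  exact not_lt.1 fun h => (hy.trans_le hyt).not_ge (hmax t ⟨ht, h⟩)

theorem exists_right_interval {a b : ι → ℕ} {a' b' : κ → ℕ} {p q r : ℕ} (hpr : p ≤ r)
    (hrq : r < q) (hle : ∀ y, y ≤ q + 1 →
      numCovering a' b' y (q + 1) ≤ numCovering a b y (q + 1))
    (heq : numCovering a' b' p (q + 1) = numCovering a b p (q + 1))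
    (hdiag : numCovering a' b' (r + 1) (r + 1) = numCovering a b (r + 1) (r + 1))
    (hlt : ∀ y, r < y → y ≤ q → numCovering a' b' p y < numCovering a b p y) :
    ∃ t, p < a' t ∧ a' t ≤ r + 1 ∧ r < b' t ∧ b' t ≤ q ∧
      ∀ p' y, p ≤ p' → p' < a' t → r < y → y ≤ q →
        numCovering a' b' p' y < numCovering a b p' y := by
  have hrect : ∀ p' y, p ≤ p' → p' ≤ y → r < y → y ≤ q →
      (∀ t, p < a' t → r < b' t → b' t ≤ q → p' < a' t) →
      numCovering a' b' p' y < numCovering a b p' y := fun p' y hp' hp'y hry hyq hbox =>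
    numCovering_lt_of_forall_not_mem_box hp' (by omega) (hlt y hry hyq) heq (hle p' (by omega))
      fun t ht hyt htq => hbox t ht (by omega) (by omega)
  obtain ⟨t₀, ht₀, ht₀r⟩ : ∃ t, (p < a' t ∧ r < b' t ∧ b' t ≤ q) ∧ a' t ≤ r + 1 := by
    by_contra! hcon
    exact (hrect (r + 1) (r + 1) (by omega) le_rfl (by omega) hrq
      fun t h₁ h₂ h₃ => hcon t ⟨h₁, h₂, h₃⟩).ne hdiag
  obtain ⟨t, ht, hmin⟩ := Finset.exists_min_image
    (Finset.univ.filter fun t => p < a' t ∧ r < b' t ∧ b' t ≤ q) a' ⟨t₀, by simpa using ht₀⟩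
  simp only [Finset.mem_filter, Finset.mem_univ, true_and] at ht hmin
  have htr : a' t ≤ r + 1 := (hmin t₀ ht₀).trans ht₀r
  exact ⟨t, ht.1, htr, ht.2.1, ht.2.2, fun p' y hp' hp't hry hyq =>
    hrect p' y hp' (by omega) hry hyq
      fun u h₁ h₂ h₃ => hp't.trans_le (hmin u ⟨h₁, h₂, h₃⟩)⟩

theorem exists_exchange {a b : ι → ℕ} {a' b' : κ → ℕ} {ℓ : ℕ} (hb : ∀ s, b s ≤ ℓ)
    (hab' : ∀ s, a' s ≤ b' s)
    (hle : ∀ p q, p ≤ q → numCovering a' b' p q ≤ numCovering a b p q)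
    (hdiag : ∀ p, numCovering a' b' p p = numCovering a b p p)
    (hne : ∃ p q, p ≤ q ∧ numCovering a' b' p q ≠ numCovering a b p q) :
    ∃ s t, a' s < a' t ∧ a' t ≤ b' s + 1 ∧ b' s < b' t ∧
      ∀ p q, a' s ≤ p → p < a' t → b' s < q → q ≤ b' t →
        numCovering a' b' p q < numCovering a b p q := by
  have hbounded : ∀ p q, p ≤ q ∧ numCovering a' b' p q ≠ numCovering a b p q → q ≤ ℓ := by
    rintro p q ⟨hpq, hpq'⟩
    by_contra! hlt
    have hzero : numCovering a b p q = 0 := numCovering_eq_zero fun s => (hb s).trans_lt hlt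
    exact hpq' (le_antisymm (hle p q hpq) (hzero ▸ Nat.zero_le _))
  obtain ⟨p, q, ⟨hpq, hpq'⟩, hrows, hcols⟩ := exists_min_row_max_column hbounded hne
  simp only [not_and, not_not] at hrows hcols
  obtain ⟨s, rfl, hsq, hlt⟩ := exists_left_interval hab' hpq hrows (hdiag p)
    ((hle p q hpq).lt_of_ne hpq')
  obtain ⟨t, hst, hts, hbst, htq, hbox⟩ := exists_right_interval (hab' s) hsq
    (fun y hy => hle y (q + 1) hy) (hcols (q + 1) q.lt_succ_self (by omega)) (hdiag (b' s + 1)) hlt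
  exact ⟨s, t, hst, hts, hbst, fun p y hsp hpt hsy hyt => hbox p y hsp hpt hsy (hyt.trans htq)⟩

theorem numCovering_comp_swap [DecidableEq κ] {a b : κ → ℕ} {s t : κ} (ha : a s < a t)
    (hb : b s < b t) (p q : ℕ) :
    numCovering a (b ∘ Equiv.swap s t) p q =
      numCovering a b p q + if a s ≤ p ∧ p < a t ∧ b s < q ∧ q ≤ b t then 1 else 0 := by
  have hst : t ≠ s := fun h => (h ▸ ha).false
  have hrest : ∀ i ∈ ({s, t} : Finset κ)ᶜ, (if a i ≤ p ∧ q ≤ (b ∘ Equiv.swap s t) i then 1 else 0) =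
      if a i ≤ p ∧ q ≤ b i then 1 else 0 := fun i hi => by
    simp only [Finset.mem_compl, Finset.mem_insert, Finset.mem_singleton, not_or] at hi
    rw [Function.comp_apply, Equiv.swap_apply_of_ne_of_ne hi.1 hi.2]
  simp only [numCovering, Finset.card_filter]
  rw [← Finset.sum_add_sum_compl {s, t}, ← Finset.sum_add_sum_compl {s, t} fun i =>
    if a i ≤ p ∧ q ≤ b i then 1 else 0, Finset.sum_congr rfl hrest, Finset.sum_pair hst.symm,
    Finset.sum_pair hst.symm]
  simp only [Function.comp_apply, Equiv.swap_apply_left, Equiv.swap_apply_right]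
  split_ifs <;> omega

end Exchange

section ExchangeVectors

variable {𝕜 E : Type*} [Field 𝕜] [AddCommGroup E] [Module 𝕜 E] {ι : Type*} [DecidableEq ι]

/-- The vectors of a decomposition into intervals after the intervals `s` and `t` have exchanged
their right ends, where `r` is the old right end of `s`: the vectors of `s` are continued by those
of `t` beyond `r`, and up to `r` those of `t` are replaced by differences, on which the map that
joins `s` to `t` compensates the old one. -/
def exchangeVectors (a : ι → ℕ) (x : ι → ℕ → E) (s t : ι) (r : ℕ) (u : ι) (v : ℕ) : E :=
  if u = s then if v ≤ r then x s v else x t v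
  else if u = t then if a t ≤ v ∧ v ≤ r then x t v - x s v else 0
  else x u v

variable {a b : ι → ℕ} {x : ι → ℕ → E} {s t : ι} {r : ℕ}

theorem exchangeVectors_left (v : ℕ) :
    exchangeVectors a x s t r s v = if v ≤ r then x s v else x t v :=
  if_pos rfl

theorem exchangeVectors_right (hst : t ≠ s) (v : ℕ) :
    exchangeVectors a x s t r t v = if a t ≤ v ∧ v ≤ r then x t v - x s v else 0 := by
  rw [exchangeVectors, if_neg hst, if_pos rfl]

theorem exchangeVectors_of_ne {u : ι} (hus : u ≠ s) (hut : u ≠ t) :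
    exchangeVectors a x s t r u = x u :=
  funext fun v => by rw [exchangeVectors, if_neg hus, if_neg hut]

namespace IntervalBasis

variable [Fintype ι] {f : ℕ → End 𝕜 E} {W : ℕ → Submodule 𝕜 E}

theorem exchangeVectors_eq_zero (h : IntervalBasis f W a b x) (ha : a s < a t) (hb : b s < b t)
    {u : ι} {v : ℕ} (hv : ¬ (a u ≤ v ∧ v ≤ (b ∘ Equiv.swap s t) u)) :
    exchangeVectors a x s t (b s) u v = 0 := by
  have hst : t ≠ s := fun hst => (hst ▸ ha).false
  by_cases hus : u = s
  · subst hus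
    rw [Function.comp_apply, Equiv.swap_apply_left] at hv
    rw [exchangeVectors_left]
    split_ifs
    · exact h.zero u v (by omega)
    · exact h.zero t v (by omega)
  by_cases hut : u = t
  · subst hut
    rw [Function.comp_apply, Equiv.swap_apply_right] at hv
    rw [exchangeVectors_right hst, if_neg hv]
  · rw [Function.comp_apply, Equiv.swap_apply_of_ne_of_ne hus hut] at hv
    rw [exchangeVectors_of_ne hus hut, h.zero u v hv]

theorem map_exchangeVectors_left (h : IntervalBasis f W a b x) (hab : a t ≤ b s + 1)
    {g : End 𝕜 E} (hgs : g (x s (b s)) = x t (b s + 1)) {v : ℕ} (hv : a s ≤ v) :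
    (f + Pi.single (b s) g : ℕ → End 𝕜 E) v (exchangeVectors a x s t (b s) s v) =
      exchangeVectors a x s t (b s) s (v + 1) := by
  rw [exchangeVectors_left, exchangeVectors_left, Pi.add_apply, LinearMap.add_apply]
  rcases lt_trichotomy v (b s) with hlt | rfl | hgt
  · rw [Pi.single_eq_of_ne hlt.ne, if_pos hlt.le, if_pos (Nat.succ_le_of_lt hlt), h.map s v hv,
      LinearMap.zero_apply, add_zero]
  · rw [Pi.single_eq_same, if_pos le_rfl, if_neg (by omega), h.map s _ hv, h.zero s _ (by omega),
      hgs, zero_add]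
  · rw [Pi.single_eq_of_ne hgt.ne', if_neg (by omega), if_neg (by omega), h.map t v (by omega),
      LinearMap.zero_apply, add_zero]

theorem map_exchangeVectors_right (h : IntervalBasis f W a b x) (ha : a s < a t)
    {g : End 𝕜 E} (hgs : g (x s (b s)) = x t (b s + 1)) (hgt : g (x t (b s)) = 0) {v : ℕ}
    (hv : a t ≤ v) :
    (f + Pi.single (b s) g : ℕ → End 𝕜 E) v (exchangeVectors a x s t (b s) t v) =
      exchangeVectors a x s t (b s) t (v + 1) := by
  have hst : t ≠ s := fun hst => (hst ▸ ha).false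
  rw [exchangeVectors_right hst, exchangeVectors_right hst, Pi.add_apply,
    LinearMap.add_apply]
  rcases lt_trichotomy v (b s) with hlt | rfl | hgt
  · rw [Pi.single_eq_of_ne hlt.ne, if_pos ⟨hv, hlt.le⟩, if_pos ⟨by omega, hlt⟩, map_sub,
      h.map t v hv, h.map s v (by omega), LinearMap.zero_apply, add_zero]
  · rw [Pi.single_eq_same, if_pos ⟨hv, le_rfl⟩, if_neg (by omega), map_sub, map_sub, h.map t _ hv,
      h.map s _ (by omega), h.zero s _ (by omega), hgs, hgt]
    simp
  · rw [if_neg (by omega), if_neg (by omega), map_zero, map_zero, add_zero]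

theorem map_exchangeVectors (h : IntervalBasis f W a b x) (ha : a s < a t) (hab : a t ≤ b s + 1)
    {g : End 𝕜 E} (hgs : g (x s (b s)) = x t (b s + 1)) (hg : ∀ u, u ≠ s → g (x u (b s)) = 0)
    (u : ι) (v : ℕ) (hv : a u ≤ v) :
    (f + Pi.single (b s) g : ℕ → End 𝕜 E) v (exchangeVectors a x s t (b s) u v) =
      exchangeVectors a x s t (b s) u (v + 1) := by
  by_cases hus : u = s
  · subst hus
    exact h.map_exchangeVectors_left hab hgs hv
  by_cases hut : u = t
  · subst hut
    exact h.map_exchangeVectors_right ha hgs (hg u hus) hv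
  rw [exchangeVectors_of_ne hus hut, Pi.add_apply, LinearMap.add_apply, h.map u v hv]
  rcases eq_or_ne v (b s) with rfl | hne
  · rw [Pi.single_eq_same, hg u hus, add_zero]
  · rw [Pi.single_eq_of_ne hne, LinearMap.zero_apply, add_zero]

theorem span_exchangeVectors (h : IntervalBasis f W a b x) (hst : t ≠ s) (v : ℕ) :
    Submodule.span 𝕜 (Set.range fun u => exchangeVectors a x s t (b s) u v) = W v := by
  rw [← h.span v]
  have hx u : x u v ∈ Submodule.span 𝕜 (Set.range fun u => x u v) := subset_span ⟨u, rfl⟩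
  have hy u : exchangeVectors a x s t (b s) u v ∈
      Submodule.span 𝕜 (Set.range fun u => exchangeVectors a x s t (b s) u v) :=
    subset_span ⟨u, rfl⟩
  refine span_eq_span ?_ ?_ <;> rintro _ ⟨u, rfl⟩
  · simp only [exchangeVectors]
    split_ifs
    exacts [hx s, hx t, sub_mem (hx t) (hx s), zero_mem _, hx u]
  have hys := hy s
  have hyt := hy t
  rw [exchangeVectors_left] at hys
  rw [exchangeVectors_right hst] at hyt
  by_cases hus : u = s
  · subst hus
    by_cases hv : v ≤ b u
    · rwa [if_pos hv] at hys
    · simp [h.zero u v (by omega)]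
  by_cases hut : u = t
  · subst hut
    by_cases hv : v ≤ b s
    · by_cases hav : a u ≤ v
      · rw [if_pos hv] at hys
        rw [if_pos ⟨hav, hv⟩] at hyt
        simpa using add_mem hyt hys
      · simp [h.zero u v (by omega)]
    · rwa [if_neg hv] at hys
  · have := hy u
    rwa [exchangeVectors_of_ne hus hut] at this

theorem exchange (h : IntervalBasis f W a b x) (ha : a s < a t) (hab : a t ≤ b s + 1)
    (hb : b s < b t) {g : End 𝕜 E} (hgs : g (x s (b s)) = x t (b s + 1))
    (hg : ∀ u, u ≠ s → g (x u (b s)) = 0) :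
    IntervalBasis (f + Pi.single (b s) g) W a (b ∘ Equiv.swap s t)
      (exchangeVectors a x s t (b s)) where
  zero _ _ := h.exchangeVectors_eq_zero ha hb
  map := h.map_exchangeVectors ha hab hgs hg
  card v := by
    rw [numCovering_comp_swap ha hb, if_neg (by omega), add_zero, h.card v]
  span := h.span_exchangeVectors fun hst => (hst ▸ ha).false

/-- Rescaling the vectors of `t` by `c` reduces a general multiple `c • g` to the case `c = 1`. -/
theorem exchange_smul (h : IntervalBasis f W a b x) (ha : a s < a t) (hab : a t ≤ b s + 1)
    (hb : b s < b t) {g : End 𝕜 E} (hgs : g (x s (b s)) = x t (b s + 1))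
    (hg : ∀ u, u ≠ s → g (x u (b s)) = 0) {c : 𝕜} (hc : c ≠ 0) :
    ∃ y, IntervalBasis (f + Pi.single (b s) (c • g)) W a (b ∘ Equiv.swap s t) y := by
  have hst : s ≠ t := fun hst => (hst ▸ ha).false
  have hw u : Pi.mulSingle (M := fun _ => 𝕜) t c u ≠ 0 := by
    rw [Pi.mulSingle_apply]
    split_ifs
    exacts [hc, one_ne_zero]
  refine ⟨_, (h.rescale hw).exchange ha hab hb ?_ fun u hu => ?_⟩
  · simp [Pi.mulSingle_eq_of_ne hst, hgs]
  · simp [hg u hu]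

end IntervalBasis

end ExchangeVectors

section Points

variable {ℓ N : ℕ}

/-- The maps of a point of the representation space, continued by zero to all arrows of
`0 → 1 → 2 → ⋯`. -/
def extendedMap (M : RepSpace ℓ N) (k : ℕ) : End ℂ (Fin N → ℂ) :=
  if h : k < ℓ then (M ⟨k, h⟩).mulVecLin else 0

/-- The spaces of the points of the representation space, continued by zero to all vertices of
`0 → 1 → 2 → ⋯`. -/
def extendedSpace (ℓ N v : ℕ) : Submodule ℂ (Fin N → ℂ) := if v ≤ ℓ then ⊤ else ⊥

/-- The rank of the composite map of a representation from the vertex `p` to the vertex `q`. -/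
def compositeRank (M : RepSpace ℓ N) (p q : ℕ) : ℕ :=
  finrank ℂ (LinearMap.range (composite (extendedMap M) p q))

theorem extendedMap_coe (M : RepSpace ℓ N) (k : Fin ℓ) : extendedMap M k = (M k).mulVecLin :=
  dif_pos k.2

theorem extendedMap_add_single (M : RepSpace ℓ N) (k : Fin ℓ) (A : Matrix (Fin N) (Fin N) ℂ) :
    extendedMap (M + Pi.single k A) = extendedMap M + Pi.single (k : ℕ) A.mulVecLin := by
  funext v
  by_cases hv : v < ℓ
  · obtain ⟨v, rfl⟩ : ∃ v' : Fin ℓ, (v' : ℕ) = v := ⟨⟨v, hv⟩, rfl⟩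
    rw [Pi.add_apply, extendedMap_coe, extendedMap_coe, Pi.add_apply]
    rcases eq_or_ne v k with rfl | hne
    · rw [Pi.single_eq_same, Pi.single_eq_same, Matrix.mulVecLin_add]
    · rw [Pi.single_eq_of_ne hne, Pi.single_eq_of_ne (Fin.val_injective.ne hne), add_zero, add_zero]
  · rw [Pi.add_apply, extendedMap, extendedMap, dif_neg hv, dif_neg hv,
      Pi.single_eq_of_ne (by omega), add_zero]

theorem map_extendedMap_le (M : RepSpace ℓ N) (v : ℕ) :
    (extendedSpace ℓ N v).map (extendedMap M v) ≤ extendedSpace ℓ N (v + 1) := by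
  by_cases hv : v < ℓ
  · rw [extendedSpace, extendedSpace, if_pos (show v + 1 ≤ ℓ from hv)]
    exact le_top
  · rw [extendedMap, dif_neg hv, Submodule.map_zero]
    exact bot_le

theorem exists_intervalBasis_extendedMap (M : RepSpace ℓ N) :
    ∃ (ι : Type) (_ : Fintype ι) (a b : ι → ℕ) (x : ι → ℕ → Fin N → ℂ),
      (∀ s, a s ≤ b s ∧ b s ≤ ℓ) ∧ IntervalBasis (extendedMap M) (extendedSpace ℓ N) a b x :=
  exists_intervalBasis _ ℓ _ (map_extendedMap_le M) fun _ hv => if_neg hv.not_ge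

namespace IntervalBasis

variable {K L : RepSpace ℓ N} {ι κ : Type*} [Fintype ι] [Fintype κ] {a b : ι → ℕ}
  {a' b' : κ → ℕ} {x y : ι → ℕ → Fin N → ℂ} {x' : κ → ℕ → Fin N → ℂ}

theorem compositeRank_eq (h : IntervalBasis (extendedMap K) (extendedSpace ℓ N) a b x) {p q : ℕ}
    (hpq : p ≤ q) (hq : q ≤ ℓ) : compositeRank K p q = numCovering a b p q := by
  rw [← h.finrank_map_composite hpq, extendedSpace, if_pos (hpq.trans hq), Submodule.map_top,
    compositeRank]

theorem numCovering_le (hK : IntervalBasis (extendedMap K) (extendedSpace ℓ N) a b x)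
    (hL : IntervalBasis (extendedMap L) (extendedSpace ℓ N) a' b' x') (hb : ∀ s, b s ≤ ℓ)
    (hle : ∀ p q, p ≤ q → q ≤ ℓ → compositeRank K p q ≤ compositeRank L p q) {p q : ℕ}
    (hpq : p ≤ q) : numCovering a b p q ≤ numCovering a' b' p q := by
  rcases le_or_gt q ℓ with hq | hq
  · rw [← hK.compositeRank_eq hpq hq, ← hL.compositeRank_eq hpq hq]
    exact hle p q hpq hq
  · rw [numCovering_eq_zero fun s => (hb s).trans_lt hq]
    exact Nat.zero_le _

/-- The basis of the space of a point at a vertex given by a decomposition into intervals. -/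
def basis (h : IntervalBasis (extendedMap K) (extendedSpace ℓ N) a b x) (v : Fin (ℓ + 1)) :
    Basis {s // a s ≤ v ∧ v ≤ b s} ℂ (Fin N → ℂ) :=
  Basis.mk (h.linearIndependent v) <| by
    rw [h.span_subtype, extendedSpace, if_pos (Nat.le_of_lt_succ v.2)]

theorem basis_apply (h : IntervalBasis (extendedMap K) (extendedSpace ℓ N) a b x)
    (v : Fin (ℓ + 1)) (s : {s // a s ≤ v ∧ v ≤ b s}) : h.basis v s = x s v :=
  Basis.mk_apply _ _ s

theorem isom (hK : IntervalBasis (extendedMap K) (extendedSpace ℓ N) a b x)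
    (hL : IntervalBasis (extendedMap L) (extendedSpace ℓ N) a b y) : K.toQRep.Isom L.toQRep := by
  let φ (v : Fin (ℓ + 1)) : (Fin N → ℂ) ≃ₗ[ℂ] (Fin N → ℂ) :=
    (hK.basis v).equiv (hL.basis v) (Equiv.refl _)
  have hφ : ∀ v s, φ v (x s v) = y s v := fun v s => by
    by_cases hs : a s ≤ v ∧ v ≤ b s
    · simpa only [basis_apply, Equiv.refl_apply] using
        (hK.basis v).equiv_apply ⟨s, hs⟩ (hL.basis v) (Equiv.refl _)
    · rw [hK.zero s v hs, hL.zero s v hs, map_zero]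
  refine ⟨φ, fun k => LinearMap.congr_fun (f := (φ k.succ).toLinearMap ∘ₗ (K k).mulVecLin)
    (g := (L k).mulVecLin ∘ₗ (φ k.castSucc).toLinearMap) ?_⟩
  refine (hK.basis k.castSucc).ext fun ⟨s, hs⟩ => ?_
  have hKk := hK.map s k hs.1
  have hLk := hL.map s k hs.1
  have hφ₀ := hφ k.castSucc s
  have hφ₁ := hφ k.succ s
  rw [extendedMap_coe] at hKk hLk
  rw [Fin.val_castSucc] at hφ₀
  rw [Fin.val_succ] at hφ₁
  rw [basis_apply]
  change φ k.succ ((K k).mulVecLin (x s k)) = (L k).mulVecLin (φ k.castSucc (x s k))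
  rw [hKk, hφ₀, hLk, hφ₁]

end IntervalBasis

theorem mem_orbit_of_isom {K L : RepSpace ℓ N} (h : L.toQRep.Isom K.toQRep) : K ∈ orbit L := by
  obtain ⟨φ, hφ⟩ := h
  let ψ (v : Fin (ℓ + 1)) : LinearMap.GeneralLinearGroup ℂ (Fin N → ℂ) :=
    LinearMap.GeneralLinearGroup.ofLinearEquiv (φ v)
  let g (v : Fin (ℓ + 1)) : GL (Fin N) ℂ := Matrix.GeneralLinearGroup.toLin.symm (ψ v)
  have hg : ∀ v, (g v).val.mulVecLin = (φ v).toLinearMap := fun v =>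
    congrArg Units.val (Matrix.GeneralLinearGroup.toLin.apply_symm_apply (ψ v))
  refine ⟨g, funext fun k => ?_⟩
  refine (Units.mul_inv_eq_iff_eq_mul (g k.castSucc)).2 (Matrix.toLin'.injective ?_)
  simp only [Matrix.toLin'_apply', Matrix.mulVecLin_mul, hg]
  exact LinearMap.ext (hφ k)

theorem mem_orbit_of_compositeRank_eq {K L : RepSpace ℓ N}
    (h : ∀ p q, p ≤ q → q ≤ ℓ → compositeRank K p q = compositeRank L p q) : K ∈ orbit L := by
  obtain ⟨ι, _, a, b, x, hab, hL⟩ := exists_intervalBasis_extendedMap L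
  obtain ⟨κ, _, a', b', x', hab', hK⟩ := exists_intervalBasis_extendedMap K
  obtain ⟨σ, rfl, rfl⟩ := exists_equiv_of_numCovering_eq (fun s => (hab s).1)
    (fun s => (hab' s).1) fun p q hpq => le_antisymm
      (hL.numCovering_le hK (fun s => (hab s).2) (fun p q hpq hq => (h p q hpq hq).ge) hpq)
      (hK.numCovering_le hL (fun s => (hab' s).2) (fun p q hpq hq => (h p q hpq hq).le) hpq)
  exact mem_orbit_of_isom ((hL.reindex σ).isom hK)

end Points

section Degeneration

variable {ℓ N : ℕ}

theorem subset_zariskiClosure (S : Set (RepSpace ℓ N)) : S ⊆ zariskiClosure S :=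
  fun _ hK _ hp => hp _ hK

theorem exists_polynomial_eval_line (p : MvPolynomial (Fin ℓ × Fin N × Fin N) ℂ)
    (K G : RepSpace ℓ N) : ∃ q : Polynomial ℂ, ∀ c : ℂ,
      q.eval c = MvPolynomial.eval (fun x => (K + c • G) x.1 x.2.1 x.2.2) p := by
  refine ⟨MvPolynomial.eval₂ Polynomial.C (fun x => Polynomial.C (K x.1 x.2.1 x.2.2) +
    Polynomial.X * Polynomial.C (G x.1 x.2.1 x.2.2)) p, fun c => ?_⟩
  rw [MvPolynomial.polynomial_eval_eval₂, MvPolynomial.eval, MvPolynomial.coe_eval₂Hom]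
  congr 1
  · ext; simp
  · funext x
    rw [Polynomial.eval_add, Polynomial.eval_C, Polynomial.eval_mul, Polynomial.eval_X,
      Polynomial.eval_C]
    rfl

theorem mem_zariskiClosure_of_line {S : Set (RepSpace ℓ N)} (K G : RepSpace ℓ N)
    (h : ∀ c : ℂ, c ≠ 0 → K + c • G ∈ S) : K ∈ zariskiClosure S := by
  intro p hp
  obtain ⟨q, hq⟩ := exists_polynomial_eval_line p K G
  have hroot : ∀ c ∈ ({0}ᶜ : Set ℂ), q.IsRoot c := fun c hc => (hq c).trans (hp _ (h c hc))
  have hzero : q = 0 := Polynomial.eq_zero_of_infinite_isRoot q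
    ((Set.finite_singleton (0 : ℂ)).infinite_compl.mono hroot)
  simpa [hzero] using (hq 0).symm

theorem baseChange_baseChange (g g' : Fin (ℓ + 1) → GL (Fin N) ℂ) (M : RepSpace ℓ N) :
    baseChange g (baseChange g' M) = baseChange (g * g') M := by
  funext k
  simp [baseChange, Matrix.mul_assoc]

theorem exists_mvPolynomial_eval_baseChange (g : Fin (ℓ + 1) → GL (Fin N) ℂ)
    (p : MvPolynomial (Fin ℓ × Fin N × Fin N) ℂ) :
    ∃ q : MvPolynomial (Fin ℓ × Fin N × Fin N) ℂ, ∀ M : RepSpace ℓ N,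
      MvPolynomial.eval (fun x => M x.1 x.2.1 x.2.2) q =
        MvPolynomial.eval (fun x => baseChange g M x.1 x.2.1 x.2.2) p := by
  refine ⟨MvPolynomial.bind₁ (fun x => ∑ j, (∑ i, MvPolynomial.C ((g x.1.succ).val x.2.1 i) *
    MvPolynomial.X (x.1, i, j)) * MvPolynomial.C ((g x.1.castSucc)⁻¹.val j x.2.2)) p,
    fun M => ?_⟩
  rw [MvPolynomial.eval, MvPolynomial.eval₂Hom_bind₁]
  congr 2
  funext x
  simp [baseChange, Matrix.mul_apply]

theorem baseChange_mem_zariskiClosure {K L : RepSpace ℓ N} (h : K ∈ zariskiClosure (orbit L))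
    (g : Fin (ℓ + 1) → GL (Fin N) ℂ) : baseChange g K ∈ zariskiClosure (orbit L) := by
  intro p hp
  obtain ⟨q, hq⟩ := exists_mvPolynomial_eval_baseChange g p
  rw [← hq K]
  refine h q ?_
  rintro _ ⟨g', rfl⟩
  rw [hq]
  exact hp _ ⟨g * g', (baseChange_baseChange g g' L).symm⟩

theorem zariskiClosure_orbit_trans {K K' L : RepSpace ℓ N} (h : K ∈ zariskiClosure (orbit K'))
    (h' : K' ∈ zariskiClosure (orbit L)) : K ∈ zariskiClosure (orbit L) := by
  intro p hp
  refine h p ?_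
  rintro _ ⟨g, rfl⟩
  exact baseChange_mem_zariskiClosure h' g p hp

theorem IntervalBasis.exists_degeneration {K : RepSpace ℓ N} {ι : Type*} [Fintype ι]
    [DecidableEq ι] {a b : ι → ℕ} {x : ι → ℕ → Fin N → ℂ}
    (h : IntervalBasis (extendedMap K) (extendedSpace ℓ N) a b x) {s t : ι} (ha : a s < a t)
    (hab : a t ≤ b s + 1) (hb : b s < b t) (hbt : b t ≤ ℓ) (has : a s ≤ b s) :
    ∃ (K' : RepSpace ℓ N) (y : ι → ℕ → Fin N → ℂ),
      IntervalBasis (extendedMap K') (extendedSpace ℓ N) a (b ∘ Equiv.swap s t) y ∧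
        K ∈ zariskiClosure (orbit K') := by
  obtain ⟨g, hg⟩ := h.exists_linearMap (b s) (Pi.single s (x t (b s + 1)))
  have hgs : g (x s (b s)) = x t (b s + 1) := by rw [hg s has le_rfl, Pi.single_eq_same]
  have hgu : ∀ u, u ≠ s → g (x u (b s)) = 0 := fun u hu => by
    by_cases hv : a u ≤ b s ∧ b s ≤ b u
    · rw [hg u hv.1 hv.2, Pi.single_eq_of_ne hu]
    · rw [h.zero u _ hv, map_zero]
  let G : RepSpace ℓ N := Pi.single ⟨b s, hb.trans_le hbt⟩ (LinearMap.toMatrix' g)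
  have hG : ∀ c : ℂ, c ≠ 0 → ∃ y, IntervalBasis (extendedMap (K + c • G)) (extendedSpace ℓ N) a
      (b ∘ Equiv.swap s t) y := fun c hc => by
    rw [← Pi.single_smul, extendedMap_add_single, ← Matrix.toLin'_apply', map_smul,
      Matrix.toLin'_toMatrix']
    exact h.exchange_smul ha hab hb hgs hgu hc
  obtain ⟨y, hy⟩ := hG 1 one_ne_zero
  refine ⟨K + (1 : ℂ) • G, y, hy, mem_zariskiClosure_of_line K G fun c hc => ?_⟩
  obtain ⟨z, hz⟩ := hG c hc
  exact mem_orbit_of_isom (hy.isom hz)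

theorem exists_degeneration_of_compositeRank_ne {K L : RepSpace ℓ N}
    (hle : ∀ p q, p ≤ q → q ≤ ℓ → compositeRank K p q ≤ compositeRank L p q)
    (hne : ∃ p q, p ≤ q ∧ q ≤ ℓ ∧ compositeRank K p q ≠ compositeRank L p q) :
    ∃ K' : RepSpace ℓ N, K ∈ zariskiClosure (orbit K') ∧
      (∀ p q, p ≤ q → q ≤ ℓ → compositeRank K p q ≤ compositeRank K' p q ∧
        compositeRank K' p q ≤ compositeRank L p q) ∧
      ∃ p q, p ≤ q ∧ q ≤ ℓ ∧ compositeRank K p q < compositeRank K' p q := by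
  classical
  obtain ⟨ι, _, a, b, x, hab, hL⟩ := exists_intervalBasis_extendedMap L
  obtain ⟨κ, _, a', b', x', hab', hK⟩ := exists_intervalBasis_extendedMap K
  obtain ⟨p, q, hpq, hq, hpq'⟩ := hne
  rw [hK.compositeRank_eq hpq hq, hL.compositeRank_eq hpq hq] at hpq'
  obtain ⟨s, t, ha, hat, hb, hbox⟩ := exists_exchange (fun s => (hab s).2) (fun s => (hab' s).1)
    (fun _ _ => hK.numCovering_le hL (fun s => (hab' s).2) hle)
    (fun p => by rw [hK.card, hL.card]) ⟨p, q, hpq, hpq'⟩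
  obtain ⟨K', y, hK', hdeg⟩ := hK.exists_degeneration ha hat hb (hab' t).2 (hab' s).1
  have hrank : ∀ p q, p ≤ q → q ≤ ℓ → compositeRank K' p q = compositeRank K p q +
      if a' s ≤ p ∧ p < a' t ∧ b' s < q ∧ q ≤ b' t then 1 else 0 := fun p q hpq hq => by
    rw [hK'.compositeRank_eq hpq hq, hK.compositeRank_eq hpq hq, numCovering_comp_swap ha hb]
  refine ⟨K', hdeg, fun p q hpq hq => ⟨by rw [hrank p q hpq hq]; exact Nat.le_add_right _ _, ?_⟩,
    a' s, b' t, (hab' s).1.trans hb.le, (hab' t).2, ?_⟩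
  · rw [hrank p q hpq hq]
    split_ifs with hin
    · rw [hK.compositeRank_eq hpq hq, hL.compositeRank_eq hpq hq]
      exact hbox p q hin.1 hin.2.1 hin.2.2.1 hin.2.2.2
    · exact hle p q hpq hq
  · rw [hrank _ _ ((hab' s).1.trans hb.le) (hab' t).2, if_pos ⟨le_rfl, ha, hb, le_rfl⟩]
    exact Nat.lt_succ_self _

theorem mem_zariskiClosure_of_compositeRank_le (K L : RepSpace ℓ N)
    (hle : ∀ p q, p ≤ q → q ≤ ℓ → compositeRank K p q ≤ compositeRank L p q) :
    K ∈ zariskiClosure (orbit L) := by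
  let pairs : Finset (Σ _ : ℕ, ℕ) := (Finset.range (ℓ + 1)).sigma fun p => Finset.Icc p ℓ
  have hpairs : ∀ {r}, r ∈ pairs ↔ r.1 ≤ r.2 ∧ r.2 ≤ ℓ := fun {r} => by
    simp only [pairs, Finset.mem_sigma, Finset.mem_range, Finset.mem_Icc]
    omega
  induction hdefect : ∑ r ∈ pairs, (compositeRank L r.1 r.2 - compositeRank K r.1 r.2)
    using Nat.strong_induction_on generalizing K with
  | _ n ih =>
    by_cases hne : ∃ p q, p ≤ q ∧ q ≤ ℓ ∧ compositeRank K p q ≠ compositeRank L p q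
    · obtain ⟨K', hdeg, hbetween, p, q, hpq, hq, hlt⟩ :=
        exists_degeneration_of_compositeRank_ne hle hne
      refine zariskiClosure_orbit_trans hdeg
        (ih _ ?_ K' (fun p q hpq hq => (hbetween p q hpq hq).2) rfl)
      rw [← hdefect]
      refine Finset.sum_lt_sum (fun r hr => ?_) ⟨⟨p, q⟩, hpairs.2 ⟨hpq, hq⟩, ?_⟩
      · exact Nat.sub_le_sub_left (hbetween _ _ (hpairs.1 hr).1 (hpairs.1 hr).2).1 _
      · exact Nat.sub_lt_sub_left (hlt.trans_le (hbetween p q hpq hq).2) hlt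
    · push Not at hne
      exact subset_zariskiClosure _ (mem_orbit_of_compositeRank_eq hne)

end Degeneration

section IntervalSums

variable {ℓ N : ℕ}

theorem QRep.Isom.refl (A : QRep ℓ) : A.Isom A :=
  ⟨fun _ => LinearEquiv.refl ℂ _, fun _ _ => rfl⟩

theorem exists_toQRep_isom (A : QRep ℓ) [∀ v, FiniteDimensional ℂ (A.space v)]
    (hA : ∀ v, finrank ℂ (A.space v) = N) : ∃ K : RepSpace ℓ N, K.toQRep.Isom A := by
  let φ (v : Fin (ℓ + 1)) : (Fin N → ℂ) ≃ₗ[ℂ] A.space v :=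
    LinearEquiv.ofFinrankEq _ _ (by rw [hA v, finrank_fin_fun])
  refine ⟨fun k => LinearMap.toMatrix'
    ((φ k.succ).symm.toLinearMap ∘ₗ A.map k ∘ₗ (φ k.castSucc).toLinearMap), φ, fun k x => ?_⟩
  change φ k.succ (Matrix.toLin' (LinearMap.toMatrix' _) x) = _
  rw [Matrix.toLin'_toMatrix']
  exact (φ k.succ).apply_symm_apply _

theorem intervalBasis_of_forall_vertex {K : RepSpace ℓ N} {ι : Type*} [Fintype ι] {a b : ι → ℕ}
    {y : ι → Fin (ℓ + 1) → Fin N → ℂ} (hb : ∀ s, b s ≤ ℓ)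
    (hzero : ∀ s (v : Fin (ℓ + 1)), ¬ (a s ≤ v ∧ v ≤ b s) → y s v = 0)
    (hmap : ∀ s (k : Fin ℓ), a s ≤ k → (K k).mulVecLin (y s k.castSucc) = y s k.succ)
    (hcard : ∀ v : Fin (ℓ + 1), numCovering a b v v = N)
    (hspan : ∀ v, Submodule.span ℂ (Set.range fun s => y s v) = ⊤) :
    IntervalBasis (extendedMap K) (extendedSpace ℓ N) a b
      fun s v => if hv : v < ℓ + 1 then y s ⟨v, hv⟩ else 0 where
  zero s v hsv := by
    split_ifs with hv
    exacts [hzero s ⟨v, hv⟩ hsv, rfl]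
  map s v hsv := by
    rcases lt_or_ge v ℓ with hv | hv
    · rw [dif_pos (by omega), dif_pos (by omega)]
      exact (LinearMap.congr_fun (extendedMap_coe K ⟨v, hv⟩) _).trans (hmap s ⟨v, hv⟩ hsv)
    · rw [extendedMap, dif_neg hv.not_gt, dif_neg (show ¬ v + 1 < ℓ + 1 by omega),
        LinearMap.zero_apply]
  card v := by
    rcases le_or_gt v ℓ with hv | hv
    · rw [extendedSpace, if_pos hv, finrank_top, finrank_fin_fun]
      exact hcard ⟨v, Nat.lt_succ_of_le hv⟩
    · rw [extendedSpace, if_neg hv.not_ge, finrank_bot,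
        numCovering_eq_zero fun s => (hb s).trans_lt hv]
  span v := by
    rcases le_or_gt v ℓ with hv | hv
    · simpa [extendedSpace, hv, Nat.lt_succ_of_le hv] using hspan ⟨v, Nat.lt_succ_of_le hv⟩
    · simp [extendedSpace, hv.not_ge]

variable {ι : Type} (α β : ι → Fin (ℓ + 1))

theorem finrank_directSum_interval [Fintype ι] (v : Fin (ℓ + 1)) :
    finrank ℂ ((directSum fun s => interval (α s) (β s)).space v) =
      numCovering (fun s => (α s : ℕ)) (fun s => (β s : ℕ)) v v := by
  classical
  have hline : ∀ s, finrank ℂ (PLift (α s ≤ v ∧ v ≤ β s) → ℂ) =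
      if (α s : ℕ) ≤ v ∧ (v : ℕ) ≤ β s then 1 else 0 := fun s => by
    rw [finrank_fintype_fun_eq_card]
    split_ifs with h
    · exact Fintype.card_eq_one_iff.2 ⟨⟨h⟩, fun _ => Subsingleton.elim _ _⟩
    · exact Fintype.card_eq_zero_iff.2 ⟨fun x => h x.down⟩
  change finrank ℂ (∀ s, PLift (α s ≤ v ∧ v ≤ β s) → ℂ) = _
  rw [finrank_pi_fintype, Finset.sum_congr rfl fun s _ => hline s, numCovering, Finset.card_filter]

variable [DecidableEq ι]

/-- The vector of the summand `s` of a direct sum of interval representations that spans this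
summand at the vertices of its interval; it is zero at the other vertices. -/
def intervalVector [Fintype ι] (s : ι) (v : Fin (ℓ + 1)) :
    (directSum fun s => interval (α s) (β s)).space v :=
  fun t _ => if t = s then 1 else 0

variable [Fintype ι] {α β}

theorem intervalVector_eq_zero {s : ι} {v : Fin (ℓ + 1)} (h : ¬ (α s ≤ v ∧ v ≤ β s)) :
    intervalVector α β s v = 0 :=
  funext fun t => funext fun y => if_neg fun hts : t = s => h (hts ▸ y.down)

theorem map_intervalVector {s : ι} {k : Fin ℓ} (h : α s ≤ k.castSucc) :
    (directSum fun s => interval (α s) (β s)).map k (intervalVector α β s k.castSucc) =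
      intervalVector α β s k.succ := by
  funext t y
  change (if α t ≤ k.castSucc ∧ k.castSucc ≤ β t then (if t = s then (1 : ℂ) else 0) else 0) =
    if t = s then (1 : ℂ) else 0
  by_cases hts : t = s
  · subst hts
    rw [if_pos ⟨h, k.castSucc_lt_succ.le.trans y.down.2⟩]
  · rw [if_neg hts, ite_self]

variable (α β) in
theorem span_intervalVector (v : Fin (ℓ + 1)) :
    Submodule.span ℂ (Set.range fun s => intervalVector α β s v) = ⊤ := by
  refine eq_top_iff.2 fun (z : ∀ s, PLift (α s ≤ v ∧ v ≤ β s) → ℂ) _ => ?_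
  refine (mem_span_range_iff_exists_fun ℂ).2
    ⟨fun s => if h : α s ≤ v ∧ v ≤ β s then z s ⟨h⟩ else 0, ?_⟩
  change ∑ s, _ • (fun t _ => if t = s then 1 else 0 : ∀ t, PLift (α t ≤ v ∧ v ≤ β t) → ℂ) = z
  funext t y
  rw [Finset.sum_apply, Finset.sum_apply]
  simp only [Pi.smul_apply, smul_eq_mul, mul_ite, mul_one, mul_zero, Finset.sum_ite_eq,
    Finset.mem_univ, if_true, dif_pos y.down]

end IntervalSums

theorem exists_intervalBasis_of_isom_directSum {ℓ N : ℕ} {ι : Type} [Fintype ι]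
    {α β : ι → Fin (ℓ + 1)} {K : RepSpace ℓ N}
    (h : K.toQRep.Isom (directSum fun s => interval (α s) (β s))) :
    ∃ x, IntervalBasis (extendedMap K) (extendedSpace ℓ N) (fun s => (α s : ℕ))
      (fun s => (β s : ℕ)) x := by
  classical
  obtain ⟨φ, hφ⟩ := h
  let ψ (v : Fin (ℓ + 1)) : (Fin N → ℂ) ≃ₗ[ℂ]
    (directSum fun s => interval (α s) (β s)).space v := φ v
  refine ⟨_, intervalBasis_of_forall_vertex (y := fun s v => (ψ v).symm (intervalVector α β s v))
    (fun s => Nat.le_of_lt_succ (β s).2) (fun s v hv => ?_) (fun s k hk => ?_) (fun v => ?_)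
    fun v => ?_⟩
  · rw [intervalVector_eq_zero hv, map_zero]
  · rw [LinearEquiv.eq_symm_apply, ← map_intervalVector hk]
    exact (hφ k _).trans (congrArg _ ((ψ k.castSucc).apply_symm_apply _))
  · rw [← finrank_directSum_interval, ← (ψ v).finrank_eq, finrank_fin_fun]
  · rw [Set.range_comp' (ψ v).symm, ← LinearEquiv.coe_coe, ← map_span, span_intervalVector,
      Submodule.map_top, LinearEquiv.range]


section Multiplicities

variable {ℓ N : ℕ} {m : Fin (ℓ + 1) → Fin (ℓ + 1) → ℕ}

/-- The number of summands of `ofMult m` whose interval contains `p` and `q`, for `p ≤ q`. -/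
def coverSum (m : Fin (ℓ + 1) → Fin (ℓ + 1) → ℕ) (p q : ℕ) : ℕ :=
  ∑ i : Fin (ℓ + 1), ∑ j : Fin (ℓ + 1), if (i : ℕ) ≤ p ∧ q ≤ (j : ℕ) then m i j else 0

theorem numCovering_eq_coverSum (m : Fin (ℓ + 1) → Fin (ℓ + 1) → ℕ) {p q : ℕ} (hpq : p ≤ q) :
    numCovering (fun s : (Σ r : {r : Fin (ℓ + 1) × Fin (ℓ + 1) // r.1 ≤ r.2},
      Fin (m r.1.1 r.1.2)) => (s.1.1.1 : ℕ)) (fun s => (s.1.1.2 : ℕ)) p q = coverSum m p q := by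
  have hfibre : ∀ r : {r : Fin (ℓ + 1) × Fin (ℓ + 1) // r.1 ≤ r.2},
      (∑ _ : Fin (m r.1.1 r.1.2), if (r.1.1 : ℕ) ≤ p ∧ q ≤ (r.1.2 : ℕ) then 1 else 0) =
        if (r.1.1 : ℕ) ≤ p ∧ q ≤ (r.1.2 : ℕ) then m r.1.1 r.1.2 else 0 := by simp
  rw [numCovering, Finset.card_filter, Fintype.sum_sigma, coverSum, ← Fintype.sum_prod_type',
    Finset.sum_congr rfl fun r _ => hfibre r,
    ← Finset.sum_subtype (Finset.univ.filter fun r : Fin (ℓ + 1) × Fin (ℓ + 1) => r.1 ≤ r.2)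
    (by simp) fun r => if (r.1 : ℕ) ≤ p ∧ q ≤ (r.2 : ℕ) then m r.1 r.2 else 0]
  refine Finset.sum_filter_of_ne fun r _ hr => ?_
  have hcover := (ite_ne_right_iff.1 hr).1
  exact Fin.le_def.2 (hcover.1.trans (hpq.trans hcover.2))

theorem exists_isom_ofMult (hm : ∀ v, v ≤ ℓ → coverSum m v v = N) :
    ∃ K : RepSpace ℓ N, K.toQRep.Isom (ofMult m) ∧
      ∀ p q, p ≤ q → q ≤ ℓ → compositeRank K p q = coverSum m p q := by
  have : ∀ v, FiniteDimensional ℂ ((ofMult m).space v) := fun v =>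
    inferInstanceAs (FiniteDimensional ℂ (∀ s : (Σ r : {r : Fin (ℓ + 1) × Fin (ℓ + 1) //
      r.1 ≤ r.2}, Fin (m r.1.1 r.1.2)), PLift (s.1.1.1 ≤ v ∧ v ≤ s.1.1.2) → ℂ))
  obtain ⟨K, hK⟩ := exists_toQRep_isom (N := N) (ofMult m) fun v => by
    rw [ofMult, finrank_directSum_interval, numCovering_eq_coverSum m le_rfl,
      hm v (Nat.le_of_lt_succ v.2)]
  obtain ⟨x, hx⟩ := exists_intervalBasis_of_isom_directSum hK
  exact ⟨K, hK, fun p q hpq hq =>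
    (hx.compositeRank_eq hpq hq).trans (numCovering_eq_coverSum m hpq)⟩

theorem degenerates_ofMult (hm : ∀ v, v ≤ ℓ → coverSum m v v = N) {M : RepSpace ℓ N}
    (h : ∀ p q, p ≤ q → q ≤ ℓ → coverSum m p q ≤ compositeRank M p q) :
    Degenerates N M.toQRep (ofMult m) := by
  obtain ⟨K, hK, hrank⟩ := exists_isom_ofMult hm
  exact ⟨M, K, .refl _, hK, mem_zariskiClosure_of_compositeRank_le K M fun p q hpq hq =>
    (hrank p q hpq hq).trans_le (h p q hpq hq)⟩

theorem ofMult_degenerates (hm : ∀ v, v ≤ ℓ → coverSum m v v = N) {M : RepSpace ℓ N}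
    (h : ∀ p q, p ≤ q → q ≤ ℓ → compositeRank M p q ≤ coverSum m p q) :
    Degenerates N (ofMult m) M.toQRep := by
  obtain ⟨K, hK, hrank⟩ := exists_isom_ofMult hm
  exact ⟨K, M, hK, .refl _, mem_zariskiClosure_of_compositeRank_le M K fun p q hpq hq =>
    (h p q hpq hq).trans_eq (hrank p q hpq hq).symm⟩

end Multiplicities

section ArrowSums

variable {ℓ N : ℕ}

/-- The sum of the entries of `a` at the arrows between the vertices `p` and `q`. -/
def arrowSum (a : Fin ℓ → ℕ) (p q : ℕ) : ℕ := ∑ k : Fin ℓ, if p ≤ k ∧ k < q then a k else 0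

theorem arrowSum_self (a : Fin ℓ → ℕ) (p : ℕ) : arrowSum a p p = 0 :=
  Finset.sum_eq_zero fun _ _ => if_neg (by omega)

theorem arrowSum_zero_last (a : Fin ℓ → ℕ) : arrowSum a 0 ℓ = ∑ k, a k :=
  Finset.sum_congr rfl fun k _ => if_pos ⟨Nat.zero_le _, k.2⟩

theorem arrowSum_add (a : Fin ℓ → ℕ) {p q r : ℕ} (hpq : p ≤ q) (hqr : q ≤ r) :
    arrowSum a p q + arrowSum a q r = arrowSum a p r := by
  simp only [arrowSum, ← Finset.sum_add_distrib]
  exact Finset.sum_congr rfl fun _ _ => by split_ifs <;> omega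

theorem arrowSum_succ (a : Fin ℓ → ℕ) {p : ℕ} (k : Fin ℓ) (hpk : p ≤ k) :
    arrowSum a p (k + 1) = arrowSum a p k + a k := by
  have hk : arrowSum a k (k + 1) = a k := by
    rw [arrowSum, Finset.sum_eq_single k fun i _ hi => if_neg fun h => hi (Fin.ext (by omega))] <;>
      simp
  rw [← arrowSum_add a hpk (Nat.le_succ k), hk]

theorem sum_diff_add {ℓ : ℕ} {e : Fin (ℓ + 1) → ℕ} (he : Monotone e) :
    ∑ k, diff e k + e 0 = e (Fin.last ℓ) := by
  induction ℓ with
  | zero => simp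
  | succ ℓ ih =>
    have hinit : ∑ k : Fin ℓ, diff e k.castSucc + e 0 = e (Fin.last ℓ).castSucc :=
      ih (e := e ∘ Fin.castSucc) (he.comp (Fin.strictMono_castSucc).monotone)
    rw [Fin.sum_univ_castSucc, add_right_comm, hinit, diff, Fin.succ_last]
    exact Nat.add_sub_cancel' (he (Fin.le_last _))

theorem coverSum_multA {a : Fin ℓ → ℕ} (ha : ∑ k, a k ≤ N) {p q : ℕ} (hpq : p ≤ q) (hq : q ≤ ℓ) :
    coverSum (multA N a) p q + arrowSum a p q = N := by
  have h_first_last : multA N a 0 (Fin.last ℓ) = N - ∑ k, a k := by simp [multA]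
  have h_first (j : Fin ℓ) : multA N a 0 j.castSucc = a j := by simp [multA, Fin.castSucc_ne_last]
  have h_last (i : Fin ℓ) : multA N a i.succ (Fin.last ℓ) = a i := by
    simp [multA, Fin.succ_ne_zero]
  have h_inner (i j : Fin ℓ) : multA N a i.succ j.castSucc = 0 := by
    simp [multA, Fin.succ_ne_zero, Fin.castSucc_ne_last]
  have h_split : ∑ k, a k = (∑ k : Fin ℓ, if q ≤ (k : ℕ) then a k else 0) +
      (∑ k : Fin ℓ, if (k : ℕ) + 1 ≤ p then a k else 0) + arrowSum a p q := by
    rw [arrowSum, ← Finset.sum_add_distrib, ← Finset.sum_add_distrib]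
    exact Finset.sum_congr rfl fun k _ => by split_ifs <;> omega
  rw [coverSum, Fin.sum_univ_succ]
  simp only [Fin.sum_univ_castSucc, h_first_last, h_first, h_last, h_inner, Fin.val_zero,
    Fin.val_last, Fin.val_castSucc, Fin.val_succ, Nat.zero_le, true_and, hq, and_true, if_true,
    ite_self, Finset.sum_const_zero, zero_add]
  omega

theorem coverSum_add (m m' : Fin (ℓ + 1) → Fin (ℓ + 1) → ℕ) (p q : ℕ) :
    coverSum (m + m') p q = coverSum m p q + coverSum m' p q := by
  simp only [coverSum, ← Finset.sum_add_distrib, Pi.add_apply]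
  exact Finset.sum_congr rfl fun i _ => Finset.sum_congr rfl fun j _ => by split_ifs <;> rfl

theorem coverSum_diagonal {p q : ℕ} (hpq : p ≤ q) (hq : q ≤ ℓ) :
    coverSum (fun i j : Fin (ℓ + 1) => if i = j then 1 else 0) p q = if p = q then 1 else 0 := by
  have hrow (i : Fin (ℓ + 1)) :
      (∑ j : Fin (ℓ + 1), if (i : ℕ) ≤ p ∧ q ≤ (j : ℕ) then if i = j then 1 else 0 else 0) =
        if (i : ℕ) ≤ p ∧ q ≤ i then 1 else 0 := by
    rw [Finset.sum_eq_single i fun j _ hj => by rw [if_neg hj.symm, ite_self]] <;> simp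
  rw [coverSum, Finset.sum_congr rfl fun i _ => hrow i]
  split_ifs with h
  · subst h
    rw [Finset.sum_eq_single ⟨p, Nat.lt_succ_of_le hq⟩ fun i _ hi => if_neg fun h =>
      hi (Fin.ext (h.1.antisymm h.2))] <;> simp
  · exact Finset.sum_eq_zero fun i _ => if_neg (by omega)

theorem coverSum_mult2 {e : Fin (ℓ + 1) → ℕ} (he : ∑ k, diff e k < N) {p q : ℕ} (hpq : p ≤ q)
    (hq : q ≤ ℓ) :
    coverSum (mult2 N e) p q + arrowSum (diff e) p q + (if p = q then 0 else 1) = N := by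
  have hA := coverSum_multA (Nat.le_sub_one_of_lt he) hpq hq
  have hmult : mult2 N e = multA (N - 1) (diff e) + fun i j => if i = j then 1 else 0 := rfl
  rw [hmult, coverSum_add, coverSum_diagonal hpq hq]
  split_ifs <;> omega

end ArrowSums

section Coranks

theorem finrank_range_add_finrank_range_le {𝕜 V V' V'' : Type*} [DivisionRing 𝕜] [AddCommGroup V]
    [Module 𝕜 V] [AddCommGroup V'] [Module 𝕜 V'] [FiniteDimensional 𝕜 V'] [AddCommGroup V'']
    [Module 𝕜 V''] (f : V →ₗ[𝕜] V') (g : V' →ₗ[𝕜] V'') :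
    finrank 𝕜 (LinearMap.range f) + finrank 𝕜 (LinearMap.range g) ≤
      finrank 𝕜 (LinearMap.range (g ∘ₗ f)) + finrank 𝕜 V' := by
  have hf := (g.domRestrict (LinearMap.range f)).finrank_range_add_finrank_ker
  have hg := g.finrank_range_add_finrank_ker
  have hker : finrank 𝕜 (LinearMap.ker (g.domRestrict (LinearMap.range f))) ≤
      finrank 𝕜 (LinearMap.ker g) := by
    rw [LinearMap.ker_domRestrict, ← Submodule.finrank_map_subtype_eq]
    exact Submodule.finrank_mono (Submodule.map_comap_le _ _)
  rw [LinearMap.range_domRestrict] at hf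
  rw [LinearMap.range_comp]
  omega

variable {ℓ N : ℕ} {M : RepSpace ℓ N}

/-- The corank of the composite map of a representation from the vertex `p` to the vertex `q`. -/
def compositeCorank (M : RepSpace ℓ N) (p q : ℕ) : ℕ := N - compositeRank M p q

theorem compositeRank_add_compositeCorank (M : RepSpace ℓ N) (p q : ℕ) :
    compositeRank M p q + compositeCorank M p q = N :=
  Nat.add_sub_cancel' ((LinearMap.finrank_range_le _).trans_eq (finrank_fin_fun ℂ))

theorem compositeCorank_self (M : RepSpace ℓ N) (p : ℕ) : compositeCorank M p p = 0 := by
  rw [compositeCorank, compositeRank, composite_self, Module.End.one_eq_id, LinearMap.range_id,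
    finrank_top, finrank_fin_fun, Nat.sub_self]

theorem compositeCorank_le_add (M : RepSpace ℓ N) {p q r : ℕ} (hpq : p ≤ q) (hqr : q ≤ r) :
    compositeCorank M p r ≤ compositeCorank M p q + compositeCorank M q r := by
  have hsylvester : compositeRank M p q + compositeRank M q r ≤ compositeRank M p r + N := by
    have h := finrank_range_add_finrank_range_le (composite (extendedMap M) p q)
      (composite (extendedMap M) q r)
    rwa [← Module.End.mul_eq_comp, composite_mul_composite _ hpq hqr, finrank_fin_fun] at h
  have hpq' := compositeRank_add_compositeCorank M p q
  have hqr' := compositeRank_add_compositeCorank M q r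
  have hpr' := compositeRank_add_compositeCorank M p r
  omega

theorem compositeCorank_mono (M : RepSpace ℓ N) {p p' q' q : ℕ} (hp : p ≤ p') (hpq : p' ≤ q')
    (hq : q' ≤ q) : compositeCorank M p' q' ≤ compositeCorank M p q := by
  refine Nat.sub_le_sub_left ?_ N
  rw [compositeRank, compositeRank, ← composite_mul_composite _ (hp.trans hpq) hq,
    Module.End.mul_eq_comp, LinearMap.range_comp]
  refine (Submodule.finrank_map_le _ _).trans (Submodule.finrank_mono ?_)
  rw [← composite_mul_composite _ hp hpq]
  exact LinearMap.range_comp_le_range _ _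

theorem compositeCorank_le_arrowSum {a : Fin ℓ → ℕ}
    (h : ∀ k : Fin ℓ, compositeCorank M k (k + 1) ≤ a k) {p q : ℕ} (hpq : p ≤ q) (hq : q ≤ ℓ) :
    compositeCorank M p q ≤ arrowSum a p q := by
  induction q, hpq using Nat.le_induction with
  | base => rw [compositeCorank_self]; exact Nat.zero_le _
  | succ q hpq ih =>
    calc compositeCorank M p (q + 1)
        ≤ compositeCorank M p q + compositeCorank M q (q + 1) :=
          compositeCorank_le_add M hpq q.le_succ
      _ ≤ arrowSum a p q + a ⟨q, hq⟩ := add_le_add (ih (Nat.le_of_succ_le hq)) (h ⟨q, hq⟩)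
      _ = arrowSum a p (q + 1) := (arrowSum_succ a ⟨q, hq⟩ hpq).symm

theorem repA_degenerates {a : Fin ℓ → ℕ}
    (h : ∀ p q, p ≤ q → q ≤ ℓ → arrowSum a p q ≤ compositeCorank M p q) :
    ∑ k, a k ≤ N ∧ Degenerates N (repA N a) M.toQRep := by
  have ha : ∑ k, a k ≤ N := by
    rw [← arrowSum_zero_last]
    exact (h 0 ℓ (Nat.zero_le _) le_rfl).trans (Nat.sub_le _ _)
  refine ⟨ha, ofMult_degenerates (fun v hv => ?_) fun p q hpq hq => ?_⟩
  · simpa only [arrowSum_self, add_zero] using coverSum_multA ha le_rfl hv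
  · have hcover := coverSum_multA ha hpq hq
    have hrank := compositeRank_add_compositeCorank M p q
    have hle := h p q hpq hq
    omega

theorem degenerates_repA {a : Fin ℓ → ℕ} (ha : ∑ k, a k ≤ N)
    (h : ∀ p q, p ≤ q → q ≤ ℓ → compositeCorank M p q ≤ arrowSum a p q) :
    Degenerates N M.toQRep (repA N a) := by
  refine degenerates_ofMult (fun v hv => ?_) fun p q hpq hq => ?_
  · simpa only [arrowSum_self, add_zero] using coverSum_multA ha le_rfl hv
  · have hcover := coverSum_multA ha hpq hq
    have hrank := compositeRank_add_compositeCorank M p q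
    have hle := h p q hpq hq
    omega

theorem degenerates_rep2 {e : Fin (ℓ + 1) → ℕ} (he : ∑ k, diff e k < N)
    (h : ∀ p q, p < q → q ≤ ℓ → compositeCorank M p q ≤ arrowSum (diff e) p q + 1) :
    Degenerates N M.toQRep (rep2 N e) := by
  refine degenerates_ofMult (fun v hv => ?_) fun p q hpq hq => ?_
  · simpa only [arrowSum_self, if_true, add_zero] using coverSum_mult2 he le_rfl hv
  · have hcover := coverSum_mult2 he hpq hq
    have hrank := compositeRank_add_compositeCorank M p q
    rcases hpq.eq_or_lt with rfl | hlt
    · rw [compositeCorank_self] at hrank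
      omega
    · have hle := h p q hlt hq
      rw [if_neg hlt.ne] at hcover
      omega

end Coranks

section Tuples

variable {ℓ N : ℕ} {e : Fin (ℓ + 1) → ℕ} {M : RepSpace ℓ N}

theorem exists_lt_compositeCorank_of_not_degenerates_repA {a : Fin ℓ → ℕ} (ha : ∑ k, a k ≤ N)
    (h : ¬ Degenerates N M.toQRep (repA N a)) : ∃ i : Fin ℓ, a i < compositeCorank M i (i + 1) := by
  by_contra! hle
  exact h (degenerates_repA ha fun p q hpq hq => compositeCorank_le_arrowSum hle hpq hq)

theorem arrowSum_tupI_le {i : Fin ℓ} (hi : diff e i < compositeCorank M i (i + 1)) (p q : ℕ) :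
    arrowSum (tupI e i) p q ≤ compositeCorank M p q := by
  have hsum : arrowSum (tupI e i) p q = if p ≤ i ∧ i < q then diff e i + 1 else 0 := by
    rw [arrowSum, Finset.sum_eq_single i fun k _ hk => by rw [tupI, if_neg hk, ite_self]] <;>
      simp [tupI]
  rw [hsum]
  split_ifs with h
  · exact hi.trans_le (compositeCorank_mono M h.1 (Nat.le_succ _) h.2)
  · exact Nat.zero_le _

theorem exists_minimal_lt_compositeCorank_of_not_degenerates_rep2 (he : ∑ k, diff e k < N)
    (h : ¬ Degenerates N M.toQRep (rep2 N e)) :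
    ∃ i j : Fin (ℓ + 1), i < j ∧ arrowSum (diff e) i j + 1 < compositeCorank M i j ∧
      ∀ p q, p ≤ q → q ≤ ℓ → q - p < j - i →
        compositeCorank M p q ≤ arrowSum (diff e) p q + 1 := by
  let S : Set (ℕ × ℕ) := {r | r.1 < r.2 ∧ r.2 ≤ ℓ ∧
    arrowSum (diff e) r.1 r.2 + 1 < compositeCorank M r.1 r.2}
  have hS : S.Nonempty := by
    by_contra hempty
    refine h (degenerates_rep2 he fun p q hpq hq => not_lt.1 fun hlt => ?_)
    exact hempty ⟨(p, q), hpq, hq, hlt⟩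
  obtain ⟨⟨i, j⟩, ⟨hij, hj, hlt⟩, hmin⟩ :=
    (measure fun r : ℕ × ℕ => r.2 - r.1).wf.has_min S hS
  refine ⟨⟨i, Nat.lt_succ_of_le (hij.le.trans hj)⟩, ⟨j, Nat.lt_succ_of_le hj⟩, hij, hlt,
    fun p q hpq hq hshort => ?_⟩
  rcases hpq.eq_or_lt with rfl | hpq
  · rw [compositeCorank_self]
    exact Nat.zero_le _
  · exact not_lt.1 fun hlt' => hmin (p, q) ⟨hpq, hq, hlt'⟩ hshort

theorem arrowSum_tupIJ (e : Fin (ℓ + 1) → ℕ) {i j : Fin (ℓ + 1)} {p q : ℕ}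
    (hpq : max p i < min q j) :
    arrowSum (tupIJ e i j) p q = arrowSum (diff e) (max p i) (min q j) +
      (if p ≤ i then 1 else 0) + if j ≤ q then 1 else 0 := by
  have hj := j.2
  have hleft : (if p ≤ (i : ℕ) then 1 else 0) = ∑ k : Fin ℓ,
      if (⟨i, by omega⟩ : Fin ℓ) = k then (if p ≤ (k : ℕ) then 1 else 0) else 0 := by simp
  have hright : (if (j : ℕ) ≤ q then 1 else 0) = ∑ k : Fin ℓ,
      if (⟨j - 1, by omega⟩ : Fin ℓ) = k then (if (k : ℕ) < q then 1 else 0) else 0 := by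
    rw [Finset.sum_ite_eq, if_pos (Finset.mem_univ _)]
    exact if_congr (show (j : ℕ) ≤ q ↔ (j : ℕ) - 1 < q by omega) rfl rfl
  simp only [hleft, hright, arrowSum, ← Finset.sum_add_distrib]
  refine Finset.sum_congr rfl fun k _ => ?_
  simp only [tupIJ, Fin.ext_iff, Fin.le_def, Fin.val_castSucc, Fin.val_succ]
  split_ifs <;> omega

theorem arrowSum_tupIJ_eq_zero (e : Fin (ℓ + 1) → ℕ) {i j : Fin (ℓ + 1)} {p q : ℕ}
    (hpq : min q j ≤ max p i) : arrowSum (tupIJ e i j) p q = 0 :=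
  Finset.sum_eq_zero fun k _ => by
    simp only [tupIJ, Fin.le_def, Fin.val_castSucc, Fin.val_succ]
    split_ifs <;> omega

theorem arrowSum_tupIJ_le {i j : Fin (ℓ + 1)}
    (hlt : arrowSum (diff e) i j + 1 < compositeCorank M i j)
    (hmin : ∀ p q, p ≤ q → q ≤ ℓ → q - p < j - i →
      compositeCorank M p q ≤ arrowSum (diff e) p q + 1) (p q : ℕ) :
    arrowSum (tupIJ e i j) p q ≤ compositeCorank M p q := by
  rcases le_or_gt (min q j : ℕ) (max p i) with hempty | hpq
  · rw [arrowSum_tupIJ_eq_zero e hempty]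
    exact Nat.zero_le _
  rw [arrowSum_tupIJ e hpq]
  have hmono : compositeCorank M (max p i) (min q j) ≤ compositeCorank M p q :=
    compositeCorank_mono M (le_max_left _ _) hpq.le (min_le_left _ _)
  have hip : (i : ℕ) ≤ max p i := le_max_right _ _
  have hqj : min q j ≤ (j : ℕ) := min_le_right _ _
  have hj : (j : ℕ) ≤ ℓ := Nat.le_of_lt_succ j.2
  have hleft : compositeCorank M i (max p i) + (if p ≤ i then 1 else 0) ≤
      arrowSum (diff e) i (max p i) + 1 := by
    split_ifs with hpi
    · rw [max_eq_right hpi, compositeCorank_self, arrowSum_self]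
    · exact hmin i (max p i) hip (by omega) (by omega)
  have hright : compositeCorank M (min q j) j + (if j ≤ q then 1 else 0) ≤
      arrowSum (diff e) (min q j) j + 1 := by
    split_ifs with hjq
    · rw [min_eq_right hjq, compositeCorank_self, arrowSum_self]
    · exact hmin (min q j) j hqj hj (by omega)
  have htriangle₁ := compositeCorank_le_add M hip (hpq.le.trans hqj)
  have htriangle₂ := compositeCorank_le_add M hpq.le hqj
  have hsum₁ := arrowSum_add (diff e) hip (hpq.le.trans hqj)
  have hsum₂ := arrowSum_add (diff e) hpq.le hqj
  omega

end Tuples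

end TypeA

end

theorem mainTheorem9_general {ℓ N : ℕ} {e : Fin (ℓ + 1) → ℕ} (he : Monotone e)
    (heN : e (Fin.last ℓ) < e 0 + N) (M : TypeA.RepSpace ℓ N) :
    (¬ TypeA.Degenerates N M.toQRep (TypeA.rep1 N e) →
      ∃ i : Fin ℓ, ∑ k, TypeA.tupI e i k ≤ N ∧
        TypeA.Degenerates N (TypeA.repA N (TypeA.tupI e i)) M.toQRep) ∧
    (¬ TypeA.Degenerates N M.toQRep (TypeA.rep2 N e) →
      ∃ i j : Fin (ℓ + 1), i < j ∧ ∑ k, TypeA.tupIJ e i j k ≤ N ∧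
        TypeA.Degenerates N (TypeA.repA N (TypeA.tupIJ e i j)) M.toQRep) := by
  have hdiff : ∑ k, TypeA.diff e k < N := by
    have := TypeA.sum_diff_add he
    omega
  refine ⟨fun h => ?_, fun h => ?_⟩
  · obtain ⟨i, hi⟩ := TypeA.exists_lt_compositeCorank_of_not_degenerates_repA hdiff.le h
    exact ⟨i, TypeA.repA_degenerates fun p q _ _ => TypeA.arrowSum_tupI_le hi p q⟩
  · obtain ⟨i, j, hij, hlt, hmin⟩ :=
      TypeA.exists_minimal_lt_compositeCorank_of_not_degenerates_rep2 hdiff h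
    exact ⟨i, j, hij, TypeA.repA_degenerates fun p q _ _ => TypeA.arrowSum_tupIJ_le hlt hmin p q⟩

theorem mainTheorem9 (ℓ N : ℕ) (hN : ℓ + 2 ≤ N)
    (e : Fin (ℓ + 1) → ℕ) (he : Monotone e) (he_first : 1 ≤ e 0) (he_last : e (Fin.last ℓ) ≤ N)
    (M : TypeA.RepSpace ℓ N) :
    (TypeA.Degenerates N M.toQRep (TypeA.rep2 N e) →
      ¬ TypeA.Degenerates N M.toQRep (TypeA.rep1 N e) →
      ∃ i : Fin ℓ, ∑ k, TypeA.tupI e i k ≤ N ∧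
        TypeA.Degenerates N (TypeA.repA N (TypeA.tupI e i)) M.toQRep) ∧
    (¬ TypeA.Degenerates N M.toQRep (TypeA.rep2 N e) →
      ∃ i j : Fin (ℓ + 1), i < j ∧ ∑ k, TypeA.tupIJ e i j k ≤ N ∧
        TypeA.Degenerates N (TypeA.repA N (TypeA.tupIJ e i j)) M.toQRep) := by
  have h := mainTheorem9_general he (by omega) M
  exact ⟨fun _ => h.1, h.2⟩
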